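/- Let $p$ be a prime and $N\ge 4$ an integer, and put $T=\{2,\ldots,N-2\}$ and $D=2(N-3)+\frac{(N-3)(N-4)}{2}$. Let $\mathbb{C}^D$ be the space of families $\boldsymbol{s}$ of complex numbers $s_{1i}$, $s_{(N-1)i}$ ($i\in T$) and $s_{ij}$ ($i,j\in T$, $i<j$). The $p$-adic open string $N$-point zeta function is $$Z^{(N)}(\boldsymbol{s})=\int_{\mathbb{Q}_p^{N-3}\smallsetminus\Lambda}\ \prod_{i=2}^{N-2}|x_i|_p^{s_{1i}}\,|1-x_i|_p^{s_{(N-1)i}}\prod_{2\le i<j\le N-2}|x_i-x_j|_p^{s_{ij}}\ \prod_{i=2}^{N-2}dx_i ,$$ where $dx_i$ is the Haar measure of $\mathbb{Q}_p$ with $\int_{\mathbb{Z}_p}dx_i=1$, and $\Lambda$ is the zero set of $\prod_{i}x_i(1-x_i)\prod_{i<j}(x_i-x_j)$. Let $H(\mathbb{C})\subseteq\mathbb{C}^D$ be the set of all $\boldsymbol{s}$ that satisfy * $|J|+\sum_{i\in J}\operatorname{Re}(s_{1i}+s_{(N-1)i})+\sum_{i<j,\ i\in J}\operatorname{Re}(s_{ij})+\sum_{i<j,\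 i\in T\smallsetminus J,\ j\in J}\operatorname{Re}(s_{ij})<0$ for every non-empty $J\subseteq T$; * $|K|-1+\sum_{i<j,\ i,j\in K}\operatorname{Re}(s_{ij})>0$ for every $K\subseteq T$ with $|K|\ge 2$ (for $K=\{i,j\}$ this is $1+\operatorname{Re}(s_{ij})>0$); * $|J|+\sum_{i\in J}\operatorname{Re}(s_{ti})+\sum_{i<j,\ i,j\in J}\operatorname{Re}(s_{ij})>0$ for every non-empty $J\subseteq T$ and $t\in\{1,N-1\}$ (for $J=\{i\}$ this is $1+\operatorname{Re}(s_{ti})>0$). (1) The set $H(\mathbb{C})$ is open and contains the non-empty open connected set given by $-\frac{2}{3}<\operatorname{Re}(s_{1i})<-\frac12$ and $-\frac23<\operatorname{Re}(s_{(N-1)i})<-\frac12$ for $i\in T$ and $-\frac{2}{3N_1}<\operatorname{Re}(s_{ij})<0$ for $i<j$ in $T$, where $N_1=\frac{(N-4)(N-3)}{2}$ (for $N=4$ the last condition is void). For every $\boldsymbol{s}\in H(\mathbb{C})$ the integral $Z^{(N)}(\boldsymbol{s})$ converges absolutely, and $Z^{(N)}$ is holomorphic on $H(\mathbb{C})$.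 It has a meromorphic continuation to $\mathbb{C}^D$ as a rational function in the variables $p^{-s_{ij}}$: there are polynomials $P,Q$ in $D$ variables over $\mathbb{C}$ such that, for all $\boldsymbol{s}\in H(\mathbb{C})$, $Q$ does not vanish at $(p^{-s_{ij}})$ and $Z^{(N)}(\boldsymbol{s})=P(p^{-s_{ij}})/Q(p^{-s_{ij}})$. The real part of every pole of this continuation (a point near which it does not extend holomorphically) lies on one of the finitely many hyperplanes of $\mathbb{R}^D$ obtained by replacing $<$ or $>$ by $=$ in one of the conditions above. (2) If $\boldsymbol{s}\in\mathbb{C}^D$ has all real parts $\operatorname{Re}(s_{1i}),\operatorname{Re}(s_{(N-1)i}),\operatorname{Re}(s_{ij})\ge 0$, then the integral diverges to $+\infty$, in the sense that the integral of the absolute value of the integrand over $\mathbb{Q}_p^{N-3}\smallsetminus\Lambda$ equals $+\infty$. -/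

import Mathlib

namespace KobaNielsen

open MeasureTheory Topology

noncomputable section

/-- The index set `T = {2, …, N - 2}` (used only for `N ≥ 4`). -/
abbrev T (N : ℕ) : Type := ↥(Finset.Icc 2 (N - 2))

/-- The pairs `ij` with `2 ≤ i < j ≤ N - 2`. -/
abbrev Pairs (N : ℕ) : Type := {q : T N × T N // q.1 < q.2}

/-- The indices of the `D = 2(N-3) + (N-3)(N-4)/2` variables: `Sum.inl i` is the index `1i`,
`Sum.inr (Sum.inl i)` is the index `(N-1)i`, and `Sum.inr (Sum.inr ⟨(i, j), _⟩)` is the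
index `ij` with `2 ≤ i < j ≤ N - 2`. -/
abbrev Idx (N : ℕ) : Type := T N ⊕ T N ⊕ Pairs N

/-- The coordinate `s_{1i}`. -/
def c1 {N : ℕ} {R : Type} (s : Idx N → R) (i : T N) : R := s (Sum.inl i)

/-- The coordinate `s_{(N-1)i}`. -/
def cLast {N : ℕ} {R : Type} (s : Idx N → R) (i : T N) : R := s (Sum.inr (Sum.inl i))

/-- The coordinate `s_{ij}`, `2 ≤ i < j ≤ N - 2`. -/
def cPair {N : ℕ} {R : Type} (s : Idx N → R) (q : Pairs N) : R := s (Sum.inr (Sum.inr q))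

/-- The vector of real parts. -/
def rePart {N : ℕ} (s : Idx N → ℂ) : Idx N → ℝ := fun k => (s k).re

/-! ### The integral -/

instance padicMeasurableSpace (p : ℕ) [Fact p.Prime] : MeasurableSpace ℚ_[p] := borel ℚ_[p]

instance padicBorelSpace (p : ℕ) [Fact p.Prime] : BorelSpace ℚ_[p] := ⟨rfl⟩

/-- `ℤ_p`, the closed unit ball of `ℚ_p`, as a compact set with non-empty interior. -/
def unitBall (p : ℕ) [Fact p.Prime] : TopologicalSpace.PositiveCompacts ℚ_[p] where
  carrier := Metric.closedBall 0 1
  isCompact' := isCompact_closedBall 0 1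
  interior_nonempty' :=
    ⟨0, Metric.ball_subset_interior_closedBall (Metric.mem_ball_self one_pos)⟩

/-- The Haar measure of `ℚ_p` with `ℤ_p` of measure one. -/
def haarQp (p : ℕ) [Fact p.Prime] : Measure ℚ_[p] := Measure.addHaarMeasure (unitBall p)

/-- The product measure `∏ dx_i` on `ℚ_p^{N-3}`. -/
def haarN (p : ℕ) [Fact p.Prime] (N : ℕ) : Measure (T N → ℚ_[p]) :=
  Measure.pi fun _ => haarQp p

/-- The set `Λ` on which some factor of the integrand vanishes. -/
def Lam (p : ℕ) [Fact p.Prime] (N : ℕ) : Set (T N → ℚ_[p]) :=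
  {x | (∏ i, x i * (1 - x i)) * ∏ q : Pairs N, (x q.1.1 - x q.1.2) = 0}

/-- The integrand `∏ |x_i|^{s_{1i}} |1 - x_i|^{s_{(N-1)i}} ∏_{i<j} |x_i - x_j|^{s_{ij}}`. -/
def integrand (p : ℕ) [Fact p.Prime] {N : ℕ} (s : Idx N → ℂ) (x : T N → ℚ_[p]) : ℂ :=
  (∏ i, ((‖x i‖ : ℝ) : ℂ) ^ c1 s i * ((‖1 - x i‖ : ℝ) : ℂ) ^ cLast s i) *
    ∏ q : Pairs N, ((‖x q.1.1 - x q.1.2‖ : ℝ) : ℂ) ^ cPair s q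

/-- The `p`-adic open string `N`-point zeta function, as an integral. -/
def zeta (p : ℕ) [Fact p.Prime] (N : ℕ) (s : Idx N → ℂ) : ℂ :=
  ∫ x in (Lam p N)ᶜ, integrand p s x ∂(haarN p N)

/-! ### The affine forms and the region of convergence -/

/-- `|J| + ∑_{i ∈ J} (σ_{1i} + σ_{(N-1)i}) + ∑ σ_{ij}`, the last sum over the pairs `i < j`
with `i ∈ J`, together with those with `i ∈ T \ J` and `j ∈ J`. -/
def formInfty {N : ℕ} (J : Finset (T N)) (σ : Idx N → ℝ) : ℝ :=
  (J.card : ℝ) + ∑ i ∈ J, (c1 σ i + cLast σ i)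
    + (∑ q : Pairs N with q.1.1 ∈ J, cPair σ q)
    + ∑ q : Pairs N with q.1.1 ∉ J ∧ q.1.2 ∈ J, cPair σ q

/-- `|K| - 1 + ∑_{i < j, i, j ∈ K} σ_{ij}`. -/
def formDiag {N : ℕ} (K : Finset (T N)) (σ : Idx N → ℝ) : ℝ :=
  (K.card : ℝ) - 1 + ∑ q : Pairs N with q.1.1 ∈ K ∧ q.1.2 ∈ K, cPair σ q

/-- `|J| + ∑_{i ∈ J} σ_{1i} + ∑_{i < j, i, j ∈ J} σ_{ij}`. -/
def formZero {N : ℕ} (J : Finset (T N)) (σ : Idx N → ℝ) : ℝ :=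
  (J.card : ℝ) + ∑ i ∈ J, c1 σ i + ∑ q : Pairs N with q.1.1 ∈ J ∧ q.1.2 ∈ J, cPair σ q

/-- `|J| + ∑_{i ∈ J} σ_{(N-1)i} + ∑_{i < j, i, j ∈ J} σ_{ij}`. -/
def formOne {N : ℕ} (J : Finset (T N)) (σ : Idx N → ℝ) : ℝ :=
  (J.card : ℝ) + ∑ i ∈ J, cLast σ i + ∑ q : Pairs N with q.1.1 ∈ J ∧ q.1.2 ∈ J, cPair σ q

/-- The region `H(ℂ)`. The conditions `1 + Re s_{ij} > 0`, `1 + Re s_{1i} > 0` and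
`1 + Re s_{(N-1)i} > 0` are the cases `K = {i, j}` and `J = {i}`. -/
def regionH (N : ℕ) : Set (Idx N → ℂ) :=
  {s | (∀ J : Finset (T N), J.Nonempty → formInfty J (rePart s) < 0) ∧
       (∀ K : Finset (T N), 2 ≤ K.card → 0 < formDiag K (rePart s)) ∧
       (∀ J : Finset (T N), J.Nonempty → 0 < formZero J (rePart s)) ∧
       (∀ J : Finset (T N), J.Nonempty → 0 < formOne J (rePart s))}

/-- The finite union of the hyperplanes of `ℝ^D` obtained by replacing the inequality signs in
the conditions that define `regionH N` by equalities. -/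
def polarHyperplanes (N : ℕ) : Set (Idx N → ℝ) :=
  {σ | (∃ J : Finset (T N), J.Nonempty ∧ formInfty J σ = 0) ∨
       (∃ K : Finset (T N), 2 ≤ K.card ∧ formDiag K σ = 0) ∨
       (∃ J : Finset (T N), J.Nonempty ∧ formZero J σ = 0) ∨
       (∃ J : Finset (T N), J.Nonempty ∧ formOne J σ = 0)}

/-- The tube `-2/(3 N₁) < Re s_{ij} < 0`, `-2/3 < Re s_{1i} < -1/2`,
`-2/3 < Re s_{(N-1)i} < -1/2`, where `N₁ = (N-4)(N-3)/2`; for `N = 4` there are no pairs `ij`. -/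
def tube (N : ℕ) : Set (Idx N → ℂ) :=
  {s | (∀ q : Pairs N, -2 / (3 * (((N : ℝ) - 4) * ((N : ℝ) - 3) / 2)) < (cPair s q).re ∧
          (cPair s q).re < 0) ∧
       (∀ i : T N, -2 / 3 < (c1 s i).re ∧ (c1 s i).re < -1 / 2) ∧
       (∀ i : T N, -2 / 3 < (cLast s i).re ∧ (cLast s i).re < -1 / 2)}

/-! ### Rational functions in the `p^{-s_{ij}}` -/

/-- The value at `(p^{-s_{ij}})` of a polynomial in variables indexed like the `s_{ij}`. -/
def evalAt (p : ℕ) {N : ℕ} (P : MvPolynomial (Idx N) ℂ) (s : Idx N → ℂ) : ℂ :=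
  MvPolynomial.eval (fun k => (p : ℂ) ^ (-(s k))) P

/-- The point `s` is a pole (a point of the polar set) of the meromorphic function
`P(p^{-s}) / Q(p^{-s})`: this function, defined off the zeros of `Q(p^{-s})`, does not extend to
a function holomorphic near `s`. -/
def IsPole (p : ℕ) {N : ℕ} (P Q : MvPolynomial (Idx N) ℂ) (s : Idx N → ℂ) : Prop :=
  ¬ ∃ g : (Idx N → ℂ) → ℂ, AnalyticAt ℂ g s ∧
      ∀ᶠ z in 𝓝 s, evalAt p Q z ≠ 0 → g z = evalAt p P z / evalAt p Q z

end

end KobaNielsen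

namespace KobaNielsen

open MeasureTheory Topology
open scoped NNReal ENNReal

noncomputable section

/-! ### The Haar measure of `ℚ_p` under multiplication and inversion -/

section Haar

variable (p : ℕ) [hp : Fact p.Prime]

/-! The projective line over `ℚ_p` is the disjoint union of `p + 1` residue discs indexed by
`ℙ¹(𝔽_p)`. Each is a copy of `ℤ_p`, by `y ↦ a + p y` for finite `a` and `y ↦ 1 / (p y)` at infinity,
and `haarQp_eq_sum` writes the Haar measure in these charts. Assigning a disc to every coordinate
cuts the integral into finitely many pieces. By the ultrametric inequality, `|x_i - x_j|` is `1` for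
distinct finite discs and `p⁻¹ |y_i - y_j|` in a common one, while the disc at infinity only adds
powers of `|p y_i|`. The same holds for the distances to `0` and `1`. So each piece is a product
over the discs (`integrandZero_projChart`) of cluster integrands `∏ |y_i - y_j| ^ w_ij`, where the
centre `0`, `1` or `∞` of a marked disc is an additional index `⊥` with `y_⊥ = 0`. Different discs
involve different coordinates, hence independent factors.

A cluster integral over `I` satisfies a recursion on the first `p`-adic digits
(`cluster_digitChart`). Digit families that are constant on `I` reproduce the integral, with total
factor `p ^ (-(|I| - 1 + w(I)))` (`card_constOn`); every other family breaks the cluster into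
strictly smaller ones. If the real part of `|I| - 1 + w(I)` is positive, the factor has norm below
one, so the integral converges (`integrable_cluster`) and the recursion can be solved for it
(`clusterIntegral_eq`). By induction, cluster integrals are rational with denominators `1 - p ^
(-(|I| - 1 + w(I)))` (`clusterIntegral_mem`).

The exponents `|I| - 1 + w(I)` are the affine forms that define the region, with a change of sign at
infinity (`exponent_pos`). This gives convergence and the rational formula on the region. Holomorphy
is read off the formula, and a denominator can vanish only where the real part of a form is zero,
hence the hyperplanes.

For divergence, when all exponents have non-negative real part the integrand has absolute value at
least one on a set of infinite measure, where the norms `|x_i|` exceed one and increase strictly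
with `i`. -/

instance isAddHaarMeasure_haarQp : (haarQp p).IsAddHaarMeasure := by
  unfold haarQp; infer_instance

instance sigmaFinite_haarQp : SigmaFinite (haarQp p) := by
  unfold haarQp; infer_instance

theorem haarQp_closedBall : haarQp p (Metric.closedBall 0 1) = 1 :=
  Measure.addHaarMeasure_self (K₀ := unitBall p)

variable {p}

/-- The reciprocal of the norm, with value `0` at `0`. -/
def invNorm {E : Type*} [NormedAddCommGroup E] (x : E) : ℝ≥0∞ := ((‖x‖₊⁻¹ : ℝ≥0) : ℝ≥0∞)

theorem measurable_invNorm {E : Type*} [NormedAddCommGroup E] [MeasurableSpace E]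
    [OpensMeasurableSpace E] : Measurable (invNorm : E → ℝ≥0∞) := by
  unfold invNorm; fun_prop

theorem invNorm_zero {E : Type*} [NormedAddCommGroup E] : invNorm (0 : E) = 0 := by
  simp [invNorm]

theorem invNorm_mul {K : Type*} [NormedField K] (x y : K) :
    invNorm (x * y) = invNorm x * invNorm y := by
  simp only [invNorm, nnnorm_mul, mul_inv, ENNReal.coe_mul]

theorem invNorm_mul_invNorm_inv {K : Type*} [NormedField K] {x : K} (hx : x ≠ 0) :
    invNorm x * invNorm x⁻¹ = 1 := by
  rw [← invNorm_mul, mul_inv_cancel₀ hx]; simp [invNorm]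

/-- The push-forward of a Haar measure under an automorphism is again a Haar measure, so uniqueness
supplies the scalar. Since `k` does not depend on `g`, testing on the unit ball will determine it.
-/
theorem exists_lintegral_haarQp_mul {c : ℚ_[p]} (hc : c ≠ 0) :
    ∃ k : ℝ≥0∞, ∀ g : ℚ_[p] → ℝ≥0∞, Measurable g →
      ∫⁻ x, g (c * x) ∂haarQp p = k * ∫⁻ x, g x ∂haarQp p := by
  let e := Homeomorph.mulLeft₀ c hc
  have hm : (Measure.map (AddMonoidHom.mulLeft c) (haarQp p)).IsAddHaarMeasure :=
    Measure.isAddHaarMeasure_map _ _ e.continuous e.surjective e.isClosedEmbedding.tendsto_cocompact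
  have h := Measure.isAddLeftInvariant_eq_smul
    (Measure.map (AddMonoidHom.mulLeft c) (haarQp p)) (haarQp p)
  refine ⟨(Measure.map (AddMonoidHom.mulLeft c) (haarQp p)).addHaarScalarFactor (haarQp p),
    fun g hg => ?_⟩
  have h2 : ∫⁻ x, g x ∂(Measure.map (AddMonoidHom.mulLeft c) (haarQp p))
      = ∫⁻ x, g (c * x) ∂haarQp p :=
    lintegral_map hg (measurable_const_mul c)
  rw [← h2]
  conv_lhs => rw [h]
  rw [lintegral_smul_measure, ENNReal.smul_def, smul_eq_mul]

theorem norm_sub_natCast_lt_one_iff (z : ℤ_[p]) (a : ZMod p) :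
    ‖z - (a.val : ℤ_[p])‖ < 1 ↔ PadicInt.toZMod z = a := by
  rw [← PadicInt.mem_nonunits, ← IsLocalRing.mem_maximalIdeal, ← PadicInt.ker_toZMod,
    RingHom.mem_ker, map_sub, map_natCast, ZMod.natCast_zmod_val, sub_eq_zero]

/-- The value group is discrete: a norm below `1` is at most `p⁻¹`. -/
theorem norm_le_inv_iff_lt_one (x : ℚ_[p]) : ‖(p : ℚ_[p])⁻¹ * x‖ ≤ 1 ↔ ‖x‖ < 1 := by
  have hp0 : (0 : ℝ) < p := by exact_mod_cast hp.out.pos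
  have h := Padic.norm_le_pow_iff_norm_lt_pow_add_one x (-1)
  rw [norm_mul, norm_inv, Padic.norm_p, inv_inv, ← le_inv_mul_iff₀ hp0, mul_one]
  simpa using h

theorem norm_natCast_padic_le_one (n : ℕ) : ‖(n : ℚ_[p])‖ ≤ 1 := by
  simpa using Padic.norm_int_le_one (p := p) n

/-- Every `p`-adic integer lies in exactly one of the residue classes modulo `p`. -/
theorem indicator_unitBall_eq_sum (x : ℚ_[p]) :
    (Metric.closedBall (0 : ℚ_[p]) 1).indicator (1 : ℚ_[p] → ℝ≥0∞) x =
      ∑ a : ZMod p, (Metric.closedBall (0 : ℚ_[p]) 1).indicator 1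
        ((p : ℚ_[p])⁻¹ * (x - (a.val : ℚ_[p]))) := by
  classical
  simp only [Set.indicator_apply, mem_closedBall_zero_iff, norm_le_inv_iff_lt_one, Pi.one_apply]
  by_cases hx : ‖x‖ ≤ 1
  · obtain ⟨z, rfl⟩ : ∃ z : ℤ_[p], (z : ℚ_[p]) = x := ⟨⟨x, hx⟩, rfl⟩
    have key : ∀ a : ZMod p, ‖(z : ℚ_[p]) - (a.val : ℚ_[p])‖ < 1 ↔ PadicInt.toZMod z = a := by
      intro a
      rw [← norm_sub_natCast_lt_one_iff, PadicInt.norm_def]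
      push_cast
      rfl
    simp only [key, if_pos hx, Finset.sum_ite_eq, Finset.mem_univ, if_true]
  · rw [if_neg hx, Finset.sum_eq_zero]
    intro a _
    rw [if_neg]
    intro h
    apply hx
    have := Padic.nonarchimedean (x - (a.val : ℚ_[p])) a.val
    rw [sub_add_cancel] at this
    exact this.trans (max_le h.le (norm_natCast_padic_le_one _))

theorem measurableSet_closedBall_padic : MeasurableSet (Metric.closedBall (0 : ℚ_[p]) 1) :=
  Metric.isClosed_closedBall.measurableSet

/-- Multiplication by `c` scales the Haar measure by the norm of `c`. -/
def ScalesHaar (c : ℚ_[p]) : Prop :=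
  ∀ g : ℚ_[p] → ℝ≥0∞, Measurable g →
    ∫⁻ x, g (c * x) ∂haarQp p = invNorm c * ∫⁻ x, g x ∂haarQp p

theorem ScalesHaar.mul {c d : ℚ_[p]} (hc : ScalesHaar c) (hd : ScalesHaar d) :
    ScalesHaar (c * d) := by
  intro g hg
  have := hd (fun x => g (c * x)) (hg.comp (by fun_prop))
  rw [hc g hg] at this
  rw [invNorm_mul, mul_comm (invNorm c), mul_assoc, ← this]
  simp only [mul_assoc]

theorem ScalesHaar.inv {c : ℚ_[p]} (h0 : c ≠ 0) (hc : ScalesHaar c) : ScalesHaar c⁻¹ := by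
  intro g hg
  have := hc (fun x => g (c⁻¹ * x)) (hg.comp (by fun_prop))
  simp only [inv_mul_cancel_left₀ h0] at this
  rw [this, ← mul_assoc, mul_comm (invNorm c⁻¹), invNorm_mul_invNorm_inv h0, one_mul]

theorem scalesHaar_one : ScalesHaar (1 : ℚ_[p]) := by
  intro g _; simp [invNorm]

theorem lintegral_indicator_unitBall :
    ∫⁻ x, (Metric.closedBall (0 : ℚ_[p]) 1).indicator 1 x ∂haarQp p = 1 := by
  rw [lintegral_indicator_one measurableSet_closedBall_padic, haarQp_closedBall]

theorem measurable_indicator_unitBall :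
    Measurable ((Metric.closedBall (0 : ℚ_[p]) 1).indicator (1 : ℚ_[p] → ℝ≥0∞)) :=
  measurable_one.indicator measurableSet_closedBall_padic

theorem padic_natCast_self_ne_zero : (p : ℚ_[p]) ≠ 0 := by exact_mod_cast hp.out.ne_zero

theorem invNorm_natCast_self : invNorm (p : ℚ_[p]) = p := by
  have : ‖(p : ℚ_[p])‖₊ = (p : ℝ≥0)⁻¹ := by ext; simp
  rw [invNorm, this, inv_inv]; simp

theorem invNorm_natCast_self_inv : invNorm (p : ℚ_[p])⁻¹ = (p : ℝ≥0∞)⁻¹ := by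
  have := invNorm_mul_invNorm_inv (padic_natCast_self_ne_zero (p := p))
  rw [invNorm_natCast_self, mul_comm] at this
  exact ENNReal.eq_inv_of_mul_eq_one_left this

/-- The unit ball is the union of `p` translates of `p ℤ_p`, so each of them has measure `1 / p`;
this fixes the scalar for `p⁻¹`. -/
theorem scalesHaar_natCast_self : ScalesHaar (p : ℚ_[p]) := by
  have hp0 := padic_natCast_self_ne_zero (p := p)
  suffices h : ScalesHaar (p : ℚ_[p])⁻¹ by simpa using h.inv (inv_ne_zero hp0)
  obtain ⟨k, hk⟩ := exists_lintegral_haarQp_mul (inv_ne_zero hp0)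
  have hkI := hk _ measurable_indicator_unitBall
  rw [lintegral_indicator_unitBall, mul_one] at hkI
  have h1 : (1 : ℝ≥0∞) = p * k := by
    rw [← lintegral_indicator_unitBall (p := p), lintegral_congr indicator_unitBall_eq_sum,
      lintegral_finsetSum]
    · have : ∀ a : ZMod p, ∫⁻ x, (Metric.closedBall (0 : ℚ_[p]) 1).indicator 1
          ((p : ℚ_[p])⁻¹ * (x - (a.val : ℚ_[p]))) ∂haarQp p = k := by
        intro a
        rw [← hkI]
        exact lintegral_sub_right_eq_self (fun x : ℚ_[p] =>
          (Metric.closedBall (0 : ℚ_[p]) 1).indicator (1 : ℚ_[p] → ℝ≥0∞) ((p : ℚ_[p])⁻¹ * x)) _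
      rw [Finset.sum_congr rfl fun a _ => this a]
      simp
    · intro a _
      exact measurable_indicator_unitBall.comp (by fun_prop)
  have hk' : k = invNorm (p : ℚ_[p])⁻¹ := by
    rw [invNorm_natCast_self_inv]
    exact ENNReal.eq_inv_of_mul_eq_one_left (by rw [mul_comm]; exact h1.symm)
  unfold ScalesHaar
  rw [← hk']; exact hk

/-- A unit maps the unit ball onto itself, so the scalar is `1`. -/
theorem scalesHaar_of_norm_eq_one {u : ℚ_[p]} (hu : ‖u‖ = 1) : ScalesHaar u := by
  have hu0 : u ≠ 0 := by rintro rfl; simp at hu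
  obtain ⟨k, hk⟩ := exists_lintegral_haarQp_mul hu0
  have hkI := hk _ measurable_indicator_unitBall
  have : ∀ x, (Metric.closedBall (0 : ℚ_[p]) 1).indicator (1 : ℚ_[p] → ℝ≥0∞) (u * x) =
      (Metric.closedBall (0 : ℚ_[p]) 1).indicator (1 : ℚ_[p] → ℝ≥0∞) x := by
    classical
    intro x
    simp only [Set.indicator_apply, mem_closedBall_zero_iff, norm_mul, hu, one_mul, Pi.one_apply]
  simp only [this, lintegral_indicator_unitBall, mul_one] at hkI
  have hu' : invNorm u = 1 := by
    have : ‖u‖₊ = 1 := by ext; simpa using hu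
    simp [invNorm, this]
  unfold ScalesHaar
  rw [hu', hkI]; exact hk

theorem scalesHaar_zpow (n : ℤ) : ScalesHaar ((p : ℚ_[p]) ^ n) := by
  have hpow : ∀ n : ℕ, ScalesHaar ((p : ℚ_[p]) ^ n) := by
    intro n
    induction n with
    | zero => simpa using scalesHaar_one
    | succ n ih => rw [pow_succ]; exact ih.mul scalesHaar_natCast_self
  obtain ⟨m, rfl | rfl⟩ := n.eq_nat_or_neg
  · simpa using hpow m
  · simpa using (hpow m).inv (pow_ne_zero _ padic_natCast_self_ne_zero)

theorem lintegral_haarQp_mul {c : ℚ_[p]} (hc : c ≠ 0) {g : ℚ_[p] → ℝ≥0∞} (hg : Measurable g) :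
    ∫⁻ x, g (c * x) ∂haarQp p = invNorm c * ∫⁻ x, g x ∂haarQp p := by
  have hp0 := padic_natCast_self_ne_zero (p := p)
  have hu : ‖c * (p : ℚ_[p]) ^ (-c.valuation)‖ = 1 := by
    rw [norm_mul, Padic.norm_eq_zpow_neg_valuation hc, Padic.norm_p_zpow, neg_neg, ← zpow_add₀]
    · simp
    · exact_mod_cast hp.out.ne_zero
  have := (scalesHaar_of_norm_eq_one hu).mul (scalesHaar_zpow c.valuation)
  rw [mul_assoc, ← zpow_add₀ hp0, neg_add_cancel, zpow_zero, mul_one] at this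
  exact this g hg

/-- The measure `dx / |x|` is invariant under inversion. -/
theorem lintegral_haarQp_inv {g : ℚ_[p] → ℝ≥0∞} (hg : Measurable g) :
    ∫⁻ x, invNorm x * g x⁻¹ ∂haarQp p = ∫⁻ x, invNorm x * g x ∂haarQp p := by
  have hm := measurable_invNorm (E := ℚ_[p])
  have inv_mul : ∀ {f : ℚ_[p] → ℝ≥0∞}, Measurable f → ∀ {c : ℚ_[p]}, c ≠ 0 →
      ∫⁻ x, invNorm x * f (c * x) ∂haarQp p = ∫⁻ x, invNorm x * f x ∂haarQp p := by
    intro f hf c hc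
    have h := lintegral_haarQp_mul hc (hm.mul hf)
    simp only [Pi.mul_apply, invNorm_mul, mul_assoc] at h
    rw [lintegral_const_mul _ (by fun_prop)] at h
    have hc1 := invNorm_mul_invNorm_inv hc
    rw [← one_mul (∫⁻ x, invNorm x * f (c * x) ∂haarQp p), ← hc1, mul_comm (invNorm c), mul_assoc,
      h, ← mul_assoc, mul_comm _ (invNorm c), hc1, one_mul]
  -- The unit sphere is an auxiliary test function whose integral `A` is finite and non-zero.
  -- Evaluating one double integral in two orders, by the invariance of `dx / |x|` under
  -- multiplication, gives both sides multiplied by `A`, which then cancels.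
  set f : ℚ_[p] → ℝ≥0∞ := (Metric.sphere (0 : ℚ_[p]) 1).indicator 1 with hf
  have hfm : Measurable f := measurable_one.indicator Metric.isClosed_sphere.measurableSet
  set A := ∫⁻ x, invNorm x * f x ∂haarQp p with hA
  have hAeq : A = haarQp p (Metric.sphere 0 1) := by
    rw [← lintegral_indicator_one Metric.isClosed_sphere.measurableSet, hA]
    refine lintegral_congr fun x => ?_
    by_cases hx : x ∈ Metric.sphere (0 : ℚ_[p]) 1
    · have : ‖x‖₊ = 1 := by ext; simpa using hx
      simp [hf, invNorm, this]
    · simp only [hf, Set.indicator_of_notMem hx, mul_zero]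
  have hA0 : A ≠ 0 := by
    rw [hAeq]
    exact (IsUltrametricDist.isOpen_sphere (0 : ℚ_[p]) one_ne_zero).measure_ne_zero _
      ⟨1, by simp⟩
  have hAtop : A ≠ ∞ := by
    rw [hAeq]
    exact ((measure_mono Metric.sphere_subset_closedBall).trans_lt
      (by rw [haarQp_closedBall]; exact ENNReal.one_lt_top)).ne
  have e1 : ∫⁻ x, ∫⁻ y, (invNorm x * f x) * (invNorm y * g (x⁻¹ * y)) ∂haarQp p ∂haarQp p =
      A * ∫⁻ x, invNorm x * g x ∂haarQp p := by
    rw [hA, ← lintegral_mul_const _ (by fun_prop)]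
    refine lintegral_congr fun x => ?_
    rw [lintegral_const_mul _ (by fun_prop)]
    rcases eq_or_ne x 0 with rfl | hx
    · simp [invNorm_zero]
    · rw [inv_mul hg (inv_ne_zero hx)]
  have e2 : ∫⁻ x, ∫⁻ y, (invNorm x * f x) * (invNorm y * g (x⁻¹ * y)) ∂haarQp p ∂haarQp p =
      A * ∫⁻ x, invNorm x * g x⁻¹ ∂haarQp p := by
    rw [lintegral_lintegral_swap]
    swap
    · exact Measurable.aemeasurable (by unfold Function.uncurry; fun_prop)
    -- The substitution `x ↦ x y` moves `y` from the argument of `g` to that of `f`.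
    have e3 : ∀ y, ∫⁻ x, (invNorm x * f x) * (invNorm y * g (x⁻¹ * y)) ∂haarQp p =
        ∫⁻ x, (invNorm y * f (x * y)) * (invNorm x * g x⁻¹) ∂haarQp p := by
      intro y
      rcases eq_or_ne y 0 with rfl | hy
      · simp [invNorm_zero]
      · have := inv_mul (f := fun x => f x * (invNorm y * g (x⁻¹ * y)))
          (by fun_prop) hy
        simp only [← mul_assoc] at this ⊢
        rw [← this]
        refine lintegral_congr fun x => ?_
        rw [_root_.mul_inv, mul_comm y⁻¹, mul_assoc x⁻¹, inv_mul_cancel₀ hy, mul_one, mul_comm y x]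
        ring
    rw [lintegral_congr e3, lintegral_lintegral_swap]
    swap
    · exact Measurable.aemeasurable (by unfold Function.uncurry; fun_prop)
    rw [hA, ← lintegral_const_mul _ (by fun_prop)]
    refine lintegral_congr fun x => ?_
    rw [lintegral_mul_const _ (by fun_prop)]
    rcases eq_or_ne x 0 with rfl | hx
    · simp [invNorm_zero]
    · rw [inv_mul hfm hx]
  exact (ENNReal.mul_right_inj hA0 hAtop).1 (e2.symm.trans e1)

/-! ### The Haar measure of `ℤ_p` and decompositions into residue classes -/

instance padicIntMeasurableSpace : MeasurableSpace ℤ_[p] := borel ℤ_[p]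

instance padicIntBorelSpace : BorelSpace ℤ_[p] := ⟨rfl⟩

/-- The inclusion of `ℤ_p` into `ℚ_p`. -/
def zpIncl (z : ℤ_[p]) : ℚ_[p] := z

theorem range_zpIncl :
    Set.range (zpIncl : ℤ_[p] → ℚ_[p]) = Metric.closedBall (0 : ℚ_[p]) 1 := by
  ext x
  simp only [Set.mem_range, mem_closedBall_zero_iff]
  exact ⟨by rintro ⟨z, rfl⟩; exact z.2, fun h => ⟨⟨x, h⟩, rfl⟩⟩

theorem measurableEmbedding_zpIncl : MeasurableEmbedding (zpIncl : ℤ_[p] → ℚ_[p]) := by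
  have h : IsClosedEmbedding (zpIncl : ℤ_[p] → ℚ_[p]) := by
    refine ⟨⟨⟨rfl⟩, Subtype.val_injective⟩, ?_⟩
    rw [range_zpIncl]
    exact Metric.isClosed_closedBall
  exact h.measurableEmbedding

variable (p) in
/-- The Haar probability measure of `ℤ_p`. -/
def haarZp : Measure ℤ_[p] := (haarQp p).comap zpIncl

theorem lintegral_haarZp (g : ℚ_[p] → ℝ≥0∞) :
    ∫⁻ y : ℤ_[p], g y ∂haarZp p = ∫⁻ x in Metric.closedBall 0 1, g x ∂haarQp p := by
  have h := (measurableEmbedding_zpIncl (p := p)).lintegral_map (μ := haarZp p) g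
  rw [haarZp, measurableEmbedding_zpIncl.map_comap, range_zpIncl] at h
  exact h.symm

instance isProbabilityMeasure_haarZp : IsProbabilityMeasure (haarZp p) := by
  constructor
  have := lintegral_haarZp (p := p) 1
  simpa [haarQp_closedBall] using this

/-- The affine chart `y ↦ a + p y` of the residue class `a`. -/
def digitChart (a : ZMod p) (y : ℤ_[p]) : ℤ_[p] := a.val + p * y

theorem measurable_digitChart (a : ZMod p) : Measurable (digitChart a) := by
  unfold digitChart
  exact Continuous.measurable (by fun_prop)

/-- Substitute `x = a + p y` in each residue class; `p⁻¹` is the modulus of multiplication by `p`.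
-/
theorem setLIntegral_unitBall {g : ℚ_[p] → ℝ≥0∞} (hg : Measurable g) :
    ∫⁻ x in Metric.closedBall 0 1, g x ∂haarQp p =
      ∑ a : ZMod p, (p : ℝ≥0∞)⁻¹ * ∫⁻ y, g (digitChart a y) ∂haarZp p := by
  have hp0 := padic_natCast_self_ne_zero (p := p)
  have ind : ∀ h : ℚ_[p] → ℝ≥0∞, ∫⁻ x in Metric.closedBall 0 1, h x ∂haarQp p =
      ∫⁻ x, (Metric.closedBall (0 : ℚ_[p]) 1).indicator 1 x * h x ∂haarQp p := by
    intro h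
    rw [← lintegral_indicator measurableSet_closedBall_padic]
    refine lintegral_congr fun x => ?_
    by_cases hx : x ∈ Metric.closedBall (0 : ℚ_[p]) 1 <;> simp only [Set.indicator_of_mem,
      Set.indicator_of_notMem, hx, not_false_eq_true, one_mul, zero_mul, Pi.one_apply]
  have hI := measurable_indicator_unitBall (p := p)
  rw [ind]
  have hsum : ∀ x : ℚ_[p], (Metric.closedBall (0 : ℚ_[p]) 1).indicator 1 x * g x =
      ∑ a : ZMod p, (Metric.closedBall (0 : ℚ_[p]) 1).indicator 1
        ((p : ℚ_[p])⁻¹ * (x - (a.val : ℚ_[p]))) * g x := by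
    intro x
    rw [indicator_unitBall_eq_sum, Finset.sum_mul]
  rw [lintegral_congr hsum, lintegral_finsetSum]
  swap
  · intro a _
    exact (hI.comp (by fun_prop)).mul hg
  refine Finset.sum_congr rfl fun a _ => ?_
  have h1 := lintegral_sub_right_eq_self (μ := haarQp p) (fun x : ℚ_[p] =>
    (Metric.closedBall (0 : ℚ_[p]) 1).indicator 1 ((p : ℚ_[p])⁻¹ * x) * g (x + (a.val : ℚ_[p])))
    (a.val : ℚ_[p])
  simp only [sub_add_cancel] at h1
  have h2 := lintegral_haarQp_mul (inv_ne_zero hp0) (g := fun x : ℚ_[p] =>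
    (Metric.closedBall (0 : ℚ_[p]) 1).indicator 1 x * g (p * x + (a.val : ℚ_[p])))
    (hI.mul (hg.comp (by fun_prop)))
  simp only [mul_inv_cancel_left₀ hp0] at h2
  have h3 := lintegral_haarZp (p := p) (fun x => g (p * x + (a.val : ℚ_[p])))
  rw [h1, h2, invNorm_natCast_self_inv, ← ind, ← h3]
  simp only [digitChart]
  push_cast
  simp only [add_comm]

theorem lintegral_haarZp_eq_sum {g : ℤ_[p] → ℝ≥0∞} (hg : Measurable g) :
    ∫⁻ y, g y ∂haarZp p =
      ∑ a : ZMod p, (p : ℝ≥0∞)⁻¹ * ∫⁻ y, g (digitChart a y) ∂haarZp p := by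
  obtain ⟨G, hG, hGg⟩ := measurableEmbedding_zpIncl.exists_measurable_extend hg
    (fun _ => inferInstance)
  have h := lintegral_haarZp (p := p) G
  rw [setLIntegral_unitBall hG] at h
  have hGg' : ∀ y : ℤ_[p], G y = g y := fun y => congrFun hGg y
  simpa only [hGg'] using h

/-- The chart `y ↦ 1 / (p y)` of the residue class of the point at infinity. -/
theorem setLIntegral_compl_unitBall {g : ℚ_[p] → ℝ≥0∞} (hg : Measurable g) :
    ∫⁻ x in (Metric.closedBall 0 1)ᶜ, g x ∂haarQp p =
      ∫⁻ y : ℤ_[p], p * invNorm y ^ 2 * g ((p * (y : ℚ_[p]))⁻¹) ∂haarZp p := by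
  have hp0 := padic_natCast_self_ne_zero (p := p)
  have hpE : (p : ℝ≥0∞) ≠ 0 := by exact_mod_cast hp.out.ne_zero
  have hm := measurable_invNorm (E := ℚ_[p])
  set C : ℚ_[p] → ℝ≥0∞ := (Metric.closedBall (0 : ℚ_[p]) 1)ᶜ.indicator 1 with hC
  have hCm : Measurable C := measurable_one.indicator measurableSet_closedBall_padic.compl
  -- Inserting `invNorm x * invNorm x⁻¹ = 1` exposes the inversion-invariant measure `dx / |x|`.
  -- Inversion maps the complement of the unit ball to `0 < |x| < 1`, and scaling by `p` then
  -- restores the unit ball without its centre.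
  have e1 : ∫⁻ x in (Metric.closedBall 0 1)ᶜ, g x ∂haarQp p =
      ∫⁻ x, invNorm x * (C x * invNorm x⁻¹ * g x) ∂haarQp p := by
    rw [← lintegral_indicator measurableSet_closedBall_padic.compl]
    refine lintegral_congr fun x => ?_
    by_cases hx : x ∈ (Metric.closedBall (0 : ℚ_[p]) 1)ᶜ
    · have hx0 : x ≠ 0 := by rintro rfl; simp at hx
      rw [hC, Set.indicator_of_mem hx, Set.indicator_of_mem hx, Pi.one_apply, one_mul, ← mul_assoc,
        invNorm_mul_invNorm_inv hx0, one_mul]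
    · rw [hC, Set.indicator_of_notMem hx, Set.indicator_of_notMem hx]; simp
  rw [e1, ← lintegral_haarQp_inv (by fun_prop)]
  have h2 := lintegral_haarQp_mul hp0 (g := fun x : ℚ_[p] =>
    invNorm x * (C x⁻¹ * invNorm x⁻¹⁻¹ * g x⁻¹)) (by fun_prop)
  rw [invNorm_natCast_self] at h2
  have h3 := lintegral_haarZp (p := p) (fun y => p * invNorm y ^ 2 * g ((p * y)⁻¹))
  have h4 : ∀ y : ℤ_[p], invNorm (y : ℚ_[p]) = invNorm y := fun _ => rfl
  simp only [h4] at h3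
  refine (ENNReal.mul_right_inj hpE (ENNReal.natCast_ne_top p)).1 ?_
  rw [← h2, h3, ← lintegral_indicator measurableSet_closedBall_padic,
    ← lintegral_const_mul _ (by
      refine Measurable.indicator ?_ measurableSet_closedBall_padic
      fun_prop)]
  refine lintegral_congr fun y => ?_
  rcases eq_or_ne y 0 with rfl | hy
  · simp [invNorm_zero]
  have key : (p * y : ℚ_[p])⁻¹ ∈ (Metric.closedBall (0 : ℚ_[p]) 1)ᶜ ↔
      y ∈ Metric.closedBall (0 : ℚ_[p]) 1 := by
    have h := norm_le_inv_iff_lt_one (p := p) (p * y)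
    rw [inv_mul_cancel_left₀ hp0] at h
    have h0 : 0 < ‖(p * y : ℚ_[p])‖ := norm_pos_iff.2 (mul_ne_zero hp0 hy)
    rw [mem_closedBall_zero_iff, h, Set.mem_compl_iff, mem_closedBall_zero_iff, not_le, norm_inv,
      one_lt_inv₀ h0]
  by_cases hyB : y ∈ Metric.closedBall (0 : ℚ_[p]) 1
  · rw [hC, Set.indicator_of_mem (key.2 hyB), Set.indicator_of_mem hyB, inv_inv, invNorm_mul,
      invNorm_natCast_self, Pi.one_apply]
    ring
  · rw [hC, Set.indicator_of_notMem (fun h => hyB (key.1 h)), Set.indicator_of_notMem hyB]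
    simp

/-- The charts of the residue classes of `ℙ¹(ℚ_p)`, indexed by `ℙ¹(𝔽_p)`. -/
def projChart (a : Option (ZMod p)) (y : ℤ_[p]) : ℚ_[p] :=
  match a with
  | none => (p * (y : ℚ_[p]))⁻¹
  | some a => (digitChart a y : ℚ_[p])

/-- The density of the Haar measure of `ℚ_p` in the charts `projChart`. -/
def projDensity (a : Option (ZMod p)) (y : ℤ_[p]) : ℝ≥0 :=
  match a with
  | none => p * ‖y‖₊⁻¹ ^ 2
  | some _ => (p : ℝ≥0)⁻¹

theorem measurable_projChart (a : Option (ZMod p)) : Measurable (projChart a) := by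
  have hm := (measurableEmbedding_zpIncl (p := p)).measurable
  cases a with
  | none => exact (hm.const_mul (p : ℚ_[p])).inv
  | some a => exact hm.comp (measurable_digitChart a)

theorem measurable_projDensity (a : Option (ZMod p)) : Measurable (projDensity a) := by
  cases a with
  | none => unfold projDensity; fun_prop
  | some a => unfold projDensity; fun_prop

theorem haarQp_eq_sum : haarQp p = ∑ a : Option (ZMod p),
    ((haarZp p).withDensity fun y => projDensity a y).map (projChart a) := by
  have hpn : (p : ℝ≥0) ≠ 0 := by exact_mod_cast hp.out.ne_zero
  refine Measure.ext_of_lintegral _ fun g hg => ?_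
  rw [lintegral_finsetSum_measure, Fintype.sum_option,
    ← lintegral_add_compl g measurableSet_closedBall_padic, setLIntegral_unitBall hg,
    setLIntegral_compl_unitBall hg,
    add_comm (∑ a : ZMod p, (p : ℝ≥0∞)⁻¹ * ∫⁻ y, g (digitChart a y) ∂haarZp p)]
  have hm := (measurableEmbedding_zpIncl (p := p)).measurable
  have h : ∀ a : Option (ZMod p), ∫⁻ x, g x ∂((haarZp p).withDensity
      fun y => projDensity a y).map (projChart a) =
      ∫⁻ y, projDensity a y * g (projChart a y) ∂haarZp p := by
    intro a
    have hd := measurable_projDensity a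
    rw [lintegral_map hg (measurable_projChart a)]
    exact lintegral_withDensity_eq_lintegral_mul _ hd.coe_nnreal_ennreal
      (hg.comp (measurable_projChart a))
  simp only [h]
  refine congrArg₂ (· + ·) (lintegral_congr fun y => ?_) (Finset.sum_congr rfl fun a _ => ?_)
  · simp only [projDensity, projChart, invNorm, ENNReal.coe_mul, ENNReal.coe_pow,
      ENNReal.coe_natCast]
  · simp only [projDensity, projChart]
    rw [ENNReal.coe_inv hpn, ENNReal.coe_natCast]
    exact (lintegral_const_mul _ (hg.comp (hm.comp (measurable_digitChart a)))).symm

theorem haarZp_eq_sum : haarZp p = ∑ a : ZMod p,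
    ((haarZp p).withDensity fun _ => ((p : ℝ≥0)⁻¹ : ℝ≥0)).map (digitChart a) := by
  have hpn : (p : ℝ≥0) ≠ 0 := by exact_mod_cast hp.out.ne_zero
  refine Measure.ext_of_lintegral _ fun g hg => ?_
  rw [lintegral_finsetSum_measure, lintegral_haarZp_eq_sum hg]
  refine Finset.sum_congr rfl fun a _ => ?_
  rw [lintegral_map hg (measurable_digitChart a), withDensity_const, lintegral_smul_measure,
    ENNReal.coe_inv hpn]
  simp

end Haar

/-! ### Product measures: charts and blocks of coordinates -/

section PiMeasure

set_option linter.unusedSectionVars false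

variable {ι A X Y : Type*} [Fintype ι] [DecidableEq ι] [Fintype A] [MeasurableSpace X] [MeasurableSpace Y]
  {μ : Measure Y} [IsProbabilityMeasure μ] {ν : Measure X} [SigmaFinite ν]
  {φ : A → Y → X} {ρ : A → Y → ℝ≥0}

theorem lintegral_pi_prod {g : ι → Y → ℝ≥0∞} (hg : ∀ i, Measurable (g i)) :
    ∫⁻ y, ∏ i, g i (y i) ∂(Measure.pi fun _ : ι => μ) = ∏ i, ∫⁻ y, g i y ∂μ := by
  have h := ProbabilityTheory.iIndepFun_pi (μ := fun _ : ι => μ) (X := g)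
    (fun i => (hg i).aemeasurable)
  refine (ProbabilityTheory.lintegral_prod_eq_prod_lintegral_of_indepFun Finset.univ
    (fun i (y : ι → Y) => g i (y i)) h fun i => (hg i).comp (measurable_pi_apply i)).trans ?_
  refine Finset.prod_congr rfl fun i _ => ?_
  have := (measurePreserving_eval (fun _ : ι => μ) i).lintegral_comp (hg i)
  exact this

theorem measurable_pi_chart (hφ : ∀ a, Measurable (φ a)) (f : ι → A) :
    Measurable fun (y : ι → Y) i => φ (f i) (y i) :=
  measurable_pi_lambda _ fun i => (hφ (f i)).comp (measurable_pi_apply i)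

theorem measurable_pi_density (hρ : ∀ a, Measurable (ρ a)) (f : ι → A) :
    Measurable fun y : ι → Y => ∏ i, ρ (f i) (y i) :=
  Finset.measurable_fun_prod _ fun i _ => (hρ (f i)).comp (measurable_pi_apply i)

/-- It suffices to compare boxes. The measure of a box is a product of sums over charts, which
expands into a sum over all choices `f` of one chart per coordinate. -/
theorem pi_eq_sum_chart (hφ : ∀ a, Measurable (φ a)) (hρ : ∀ a, Measurable (ρ a))
    (hν : ν = ∑ a, (μ.withDensity fun y => ρ a y).map (φ a)) :
    Measure.pi (fun _ : ι => ν) =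
      ∑ f : ι → A, ((Measure.pi fun _ : ι => μ).withDensity
        fun y => ((∏ i, ρ (f i) (y i) : ℝ≥0) : ℝ≥0∞)).map fun y i => φ (f i) (y i) := by
  refine Measure.pi_eq fun s hs => ?_
  have h1 : ∀ i a, ((μ.withDensity fun y => ρ a y).map (φ a)) (s i) =
      ∫⁻ y, (φ a ⁻¹' s i).indicator (fun y => (ρ a y : ℝ≥0∞)) y ∂μ := by
    intro i a
    rw [Measure.map_apply (hφ a) (hs i), withDensity_apply _ (hφ a (hs i)),
      lintegral_indicator (hφ a (hs i))]
  have h2 : ∀ i, ν (s i) = ∑ a,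
      ∫⁻ y, (φ a ⁻¹' s i).indicator (fun y => (ρ a y : ℝ≥0∞)) y ∂μ := by
    intro i
    conv_lhs => rw [hν]
    rw [Measure.finsetSum_apply]
    exact Finset.sum_congr rfl fun a _ => h1 i a
  simp only [h2]
  rw [Finset.prod_univ_sum, Fintype.piFinset_univ, Measure.finsetSum_apply]
  refine Finset.sum_congr rfl fun f _ => ?_
  rw [← lintegral_pi_prod fun i => (hρ (f i)).coe_nnreal_ennreal.indicator (hφ (f i) (hs i)),
    Measure.map_apply (measurable_pi_chart hφ f) (MeasurableSet.univ_pi hs), withDensity_apply _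
      (measurable_pi_chart hφ f (MeasurableSet.univ_pi hs)),
    ← lintegral_indicator (measurable_pi_chart hφ f (MeasurableSet.univ_pi hs))]
  refine lintegral_congr fun y => ?_
  by_cases hy : ∀ i, φ (f i) (y i) ∈ s i
  · rw [Set.indicator_of_mem (by simpa using hy)]
    push_cast
    exact Finset.prod_congr rfl fun i _ =>
      (Set.indicator_of_mem (s := φ (f i) ⁻¹' s i) (hy i)
        (fun y => (ρ (f i) y : ℝ≥0∞))).symm
  · rw [Set.indicator_of_notMem (by simpa using hy)]
    push Not at hy
    obtain ⟨i, hi⟩ := hy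
    exact (Finset.prod_eq_zero (Finset.mem_univ i)
      (Set.indicator_of_notMem (s := φ (f i) ⁻¹' s i) hi _)).symm

theorem lintegral_pi_eq_sum_chart (hφ : ∀ a, Measurable (φ a)) (hρ : ∀ a, Measurable (ρ a))
    (hν : ν = ∑ a, (μ.withDensity fun y => ρ a y).map (φ a))
    {G : (ι → X) → ℝ≥0∞} (hG : Measurable G) :
    ∫⁻ x, G x ∂(Measure.pi fun _ : ι => ν) =
      ∑ f : ι → A, ∫⁻ y, ((∏ i, ρ (f i) (y i) : ℝ≥0) : ℝ≥0∞) * G (fun i => φ (f i) (y i))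
        ∂(Measure.pi fun _ : ι => μ) := by
  rw [pi_eq_sum_chart hφ hρ hν, lintegral_finsetSum_measure]
  refine Finset.sum_congr rfl fun f _ => ?_
  rw [lintegral_map hG (measurable_pi_chart hφ f)]
  exact lintegral_withDensity_eq_lintegral_mul _
    (measurable_pi_density hρ f).coe_nnreal_ennreal (hG.comp (measurable_pi_chart hφ f))

theorem integrable_integral_pi_chart (hφ : ∀ a, Measurable (φ a)) (hρ : ∀ a, Measurable (ρ a))
    (hν : ν = ∑ a, (μ.withDensity fun y => ρ a y).map (φ a))
    {G : (ι → X) → ℂ} (hG : Measurable G)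
    (hint : ∀ f : ι → A, Integrable
      (fun y => ((∏ i, ρ (f i) (y i) : ℝ≥0) : ℂ) * G (fun i => φ (f i) (y i)))
      (Measure.pi fun _ : ι => μ)) :
    Integrable G (Measure.pi fun _ : ι => ν) ∧
    ∫ x, G x ∂(Measure.pi fun _ : ι => ν) =
      ∑ f : ι → A, ∫ y, ((∏ i, ρ (f i) (y i) : ℝ≥0) : ℂ) * G (fun i => φ (f i) (y i))
        ∂(Measure.pi fun _ : ι => μ) := by
  have hsmul : ∀ (r : ℝ≥0) (z : ℂ), r • z = ((r : ℝ) : ℂ) * z := fun r z => by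
    rw [NNReal.smul_def, Complex.real_smul]
  have key : ∀ f : ι → A, Integrable G (((Measure.pi fun _ : ι => μ).withDensity
        fun y => ((∏ i, ρ (f i) (y i) : ℝ≥0) : ℝ≥0∞)).map fun y i => φ (f i) (y i)) := by
    intro f
    rw [integrable_map_measure hG.aestronglyMeasurable (measurable_pi_chart hφ f).aemeasurable,
      integrable_withDensity_iff_integrable_smul (measurable_pi_density hρ f)]
    simpa only [hsmul, Function.comp_def] using hint f
  rw [pi_eq_sum_chart hφ hρ hν]
  refine ⟨integrable_finsetSum_measure.2 fun f _ => key f, ?_⟩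
  rw [integral_finsetSum_measure fun f _ => key f]
  refine Finset.sum_congr rfl fun f _ => ?_
  rw [integral_map (measurable_pi_chart hφ f).aemeasurable hG.aestronglyMeasurable,
    integral_withDensity_eq_integral_smul (measurable_pi_density hρ f)]
  simp only [hsmul]

/-- Functions of disjoint sets of coordinates are independent. -/
theorem indepFun_of_dependsOn {β γ : Type*} [MeasurableSpace β] [MeasurableSpace γ]
    {S U : Finset ι} (hSU : Disjoint S U) {f : (ι → Y) → β} {g : (ι → Y) → γ}
    (hf : Measurable f) (hg : Measurable g) (hfS : DependsOn f (S : Set ι))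
    (hgU : DependsOn g (U : Set ι)) :
    ProbabilityTheory.IndepFun f g (Measure.pi fun _ : ι => μ) := by
  -- A base point is needed to extend partial families of coordinates to full ones. It exists
  -- because a probability measure cannot live on an empty space.
  have hne : Nonempty Y := by
    by_contra h
    rw [not_nonempty_iff] at h
    have := measure_univ (μ := μ)
    rw [Set.univ_eq_empty_iff.2 h] at this
    simp at this
  obtain ⟨y₀⟩ := hne
  have ext_meas : ∀ V : Finset ι, Measurable
      (fun (z : V → Y) i => if h : i ∈ V then z ⟨i, h⟩ else y₀) := by
    intro V
    refine measurable_pi_lambda _ fun i => ?_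
    by_cases h : i ∈ V
    · simp only [h, dite_true]; exact measurable_pi_apply _
    · simp only [h, dite_false]; exact measurable_const
  have h := ProbabilityTheory.iIndepFun_pi (μ := fun _ : ι => μ) (X := fun _ y => y)
    (fun i => aemeasurable_id)
  have h2 := (h.indepFun_finset S U hSU fun i => measurable_pi_apply i).comp
    (hf.comp (ext_meas S)) (hg.comp (ext_meas U))
  convert h2 using 1
  · funext y
    refine hfS fun i hi => ?_
    simp [Finset.mem_coe.1 hi]
  · funext y
    refine hgU fun i hi => ?_
    simp [Finset.mem_coe.1 hi]

theorem dependsOn_prod {κ M : Type*} [CommMonoid M] (s : Finset κ) {S : κ → Finset ι}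
    {g : κ → (ι → Y) → M} (hg : ∀ a, DependsOn (g a) (S a : Set ι)) :
    DependsOn (fun y => ∏ a ∈ s, g a y) ((s.biUnion S : Finset ι) : Set ι) := by
  intro y y' h
  refine Finset.prod_congr rfl fun a ha => hg a fun i hi => h i ?_
  exact Finset.mem_coe.2 (Finset.mem_biUnion.2 ⟨a, ha, hi⟩)

/-- By induction on `s`: the new factor uses coordinates disjoint from those of the remaining
product, hence is independent of it. -/
theorem lintegral_prod_of_dependsOn {κ : Type*} (s : Finset κ) {S : κ → Finset ι}
    (hS : ∀ a b, a ≠ b → Disjoint (S a) (S b)) {g : κ → (ι → Y) → ℝ≥0∞}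
    (hm : ∀ a, Measurable (g a)) (hg : ∀ a, DependsOn (g a) (S a : Set ι)) :
    ∫⁻ y, ∏ a ∈ s, g a y ∂(Measure.pi fun _ : ι => μ) =
      ∏ a ∈ s, ∫⁻ y, g a y ∂(Measure.pi fun _ : ι => μ) := by
  classical
  induction s using Finset.induction_on with
  | empty => simp
  | insert a s ha ih =>
    simp only [Finset.prod_insert ha]
    have hd : Disjoint (S a) (s.biUnion S) := by
      rw [Finset.disjoint_biUnion_right]
      intro b hb
      exact hS a b (by rintro rfl; exact ha hb)
    have hi := indepFun_of_dependsOn (μ := μ) hd (hm a)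
      (Finset.measurable_fun_prod s fun b _ => hm b) (hg a) (dependsOn_prod s hg)
    rw [← ih]
    exact ProbabilityTheory.lintegral_mul_eq_lintegral_mul_lintegral_of_indepFun (hm a)
      (Finset.measurable_fun_prod s fun b _ => hm b) hi

theorem integral_prod_of_dependsOn {κ : Type*} (s : Finset κ) {S : κ → Finset ι}
    (hS : ∀ a b, a ≠ b → Disjoint (S a) (S b)) {g : κ → (ι → Y) → ℂ}
    (hm : ∀ a, Measurable (g a)) (hg : ∀ a, DependsOn (g a) (S a : Set ι)) :
    ∫ y, ∏ a ∈ s, g a y ∂(Measure.pi fun _ : ι => μ) =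
      ∏ a ∈ s, ∫ y, g a y ∂(Measure.pi fun _ : ι => μ) := by
  classical
  induction s using Finset.induction_on with
  | empty => simp
  | insert a s ha ih =>
    simp only [Finset.prod_insert ha]
    have hd : Disjoint (S a) (s.biUnion S) := by
      rw [Finset.disjoint_biUnion_right]
      intro b hb
      exact hS a b (by rintro rfl; exact ha hb)
    have hi := indepFun_of_dependsOn (μ := μ) hd (hm a)
      (Finset.measurable_fun_prod s fun b _ => hm b) (hg a) (dependsOn_prod s hg)
    rw [← ih]
    exact hi.integral_fun_mul_eq_mul_integral (hm a).aestronglyMeasurable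
      (Finset.measurable_fun_prod s fun b _ => hm b).aestronglyMeasurable

theorem integrable_prod_of_dependsOn {κ : Type*} (s : Finset κ) {S : κ → Finset ι}
    (hS : ∀ a b, a ≠ b → Disjoint (S a) (S b)) {g : κ → (ι → Y) → ℂ}
    (hm : ∀ a, Measurable (g a)) (hg : ∀ a, DependsOn (g a) (S a : Set ι))
    (hint : ∀ a ∈ s, Integrable (g a) (Measure.pi fun _ : ι => μ)) :
    Integrable (fun y => ∏ a ∈ s, g a y) (Measure.pi fun _ : ι => μ) := by
  refine ⟨(Finset.measurable_fun_prod s fun b _ => hm b).aestronglyMeasurable, ?_⟩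
  rw [hasFiniteIntegral_iff_enorm]
  have h : ∀ y, ‖∏ a ∈ s, g a y‖ₑ = ∏ a ∈ s, ‖g a y‖ₑ := by
    intro y
    simp only [enorm_eq_nnnorm, nnnorm_prod, ENNReal.ofNNReal_finsetProd]
  simp only [h]
  rw [lintegral_prod_of_dependsOn s hS (fun a => (hm a).enorm)
    (fun a y y' hyy => by simp only [hg a hyy])]
  exact ENNReal.prod_lt_top fun a ha => (hint a ha).2

end PiMeasure

/-! ### Complex powers vanishing at the origin -/

section Cpw

/-- The power `t ^ s`, with value `0` at `t = 0` for every exponent. -/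
def cpw (t : ℝ) (s : ℂ) : ℂ := if t = 0 then 0 else (t : ℂ) ^ s

theorem cpw_zero (s : ℂ) : cpw 0 s = 0 := by simp [cpw]

theorem cpw_one (s : ℂ) : cpw 1 s = 1 := by simp [cpw]

theorem cpw_of_ne_zero {t : ℝ} (ht : t ≠ 0) (s : ℂ) : cpw t s = (t : ℂ) ^ s := by simp [cpw, ht]

theorem cpw_mul {t u : ℝ} (ht : 0 ≤ t) (hu : 0 ≤ u) (s : ℂ) :
    cpw (t * u) s = cpw t s * cpw u s := by
  rcases ht.eq_or_lt with rfl | ht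
  · simp [cpw_zero]
  rcases hu.eq_or_lt with rfl | hu
  · simp [cpw_zero]
  rw [cpw_of_ne_zero (mul_pos ht hu).ne', cpw_of_ne_zero ht.ne', cpw_of_ne_zero hu.ne',
    Complex.ofReal_mul, Complex.mul_cpow_ofReal_nonneg ht.le hu.le]

/-- The default value makes the rule unconditional; with the usual `0 ^ 0 = 1` it would fail at `t =
0` when `s + r = 0` and `s ≠ 0`. -/
theorem cpw_add (t : ℝ) (s r : ℂ) : cpw t (s + r) = cpw t s * cpw t r := by
  by_cases ht : t = 0
  · simp [cpw, ht]
  · rw [cpw_of_ne_zero ht, cpw_of_ne_zero ht, cpw_of_ne_zero ht,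
      Complex.cpow_add _ _ (by exact_mod_cast ht)]

theorem cpw_sum {κ : Type*} {t : ℝ} (ht : t ≠ 0) (A : Finset κ) (s : κ → ℂ) :
    cpw t (∑ a ∈ A, s a) = ∏ a ∈ A, cpw t (s a) := by
  classical
  induction A using Finset.induction_on with
  | empty => simp [cpw, ht]
  | insert a A ha ih => rw [Finset.sum_insert ha, Finset.prod_insert ha, cpw_add, ih]

theorem cpw_inv_natCast (p : ℕ) (hp : p ≠ 0) (s : ℂ) : cpw (p : ℝ)⁻¹ s = (p : ℂ) ^ (-s) := by
  rw [cpw_of_ne_zero (by positivity), Complex.ofReal_inv, Complex.ofReal_natCast,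
    Complex.inv_cpow, Complex.cpow_neg]
  rw [Complex.natCast_arg]
  exact Real.pi_pos.ne

theorem cpw_inv {t : ℝ} (ht : 0 ≤ t) (s : ℂ) : cpw t⁻¹ s = cpw t (-s) := by
  rcases ht.eq_or_lt with rfl | ht
  · simp [cpw_zero]
  rw [cpw_of_ne_zero (by positivity), cpw_of_ne_zero ht.ne', Complex.ofReal_inv,
    Complex.inv_cpow, Complex.cpow_neg]
  rw [Complex.arg_ofReal_of_nonneg ht.le]
  exact Real.pi_pos.ne

theorem measurable_cpw (s : ℂ) : Measurable fun t : ℝ => cpw t s := by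
  unfold cpw
  refine Measurable.ite (measurableSet_singleton 0) measurable_const ?_
  fun_prop

end Cpw

/-! ### Cluster integrals -/

section Cluster

variable {p : ℕ} [hp : Fact p.Prime] {τ : Type*} [Fintype τ] [LinearOrder τ]

set_option linter.unusedSectionVars false

/-- Extend a family by the value `0` at the additional index `⊥`. -/
def extendZero {R : Type*} [Zero R] (y : τ → R) : WithBot τ → R
  | ⊥ => 0
  | (i : τ) => y i

/-- The pairs `i < j` of elements of `I`. -/
def pairsIn (I : Finset (WithBot τ)) : Finset (WithBot τ × WithBot τ) :=
  (I ×ˢ I).filter fun q => q.1 < q.2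

theorem mem_pairsIn {I : Finset (WithBot τ)} {q : WithBot τ × WithBot τ} :
    q ∈ pairsIn I ↔ (q.1 ∈ I ∧ q.2 ∈ I) ∧ q.1 < q.2 := by
  simp [pairsIn]

/-- The integrand of the cluster integral: the product of `|y_i - y_j| ^ w_{ij}` over the pairs in
`I`, where `y_⊥ = 0`. -/
def cluster (w : WithBot τ × WithBot τ → ℂ) (I : Finset (WithBot τ)) (y : τ → ℤ_[p]) : ℂ :=
  ∏ q ∈ pairsIn I, cpw ‖extendZero y q.1 - extendZero y q.2‖ (w q)

/-- The sum of the weights of the pairs in `I`. -/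
def weightSum (w : WithBot τ × WithBot τ → ℂ) (I : Finset (WithBot τ)) : ℂ :=
  ∑ q ∈ pairsIn I, w q

variable (p τ) in
/-- The Haar probability measure of `ℤ_p^τ`. -/
abbrev haarPi : Measure (τ → ℤ_[p]) := Measure.pi fun _ : τ => haarZp p

/-- The cluster integral. -/
def clusterIntegral (p : ℕ) [Fact p.Prime] (w : WithBot τ × WithBot τ → ℂ)
    (I : Finset (WithBot τ)) : ℂ :=
  ∫ y, cluster w I y ∂haarPi p τ

/-- The elements of `I` with digit `a`. -/
def fibre (f : τ → ZMod p) (I : Finset (WithBot τ)) (a : ZMod p) : Finset (WithBot τ) :=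
  I.filter fun k => extendZero f k = a

theorem toZMod_digitChart (a : ZMod p) (y : ℤ_[p]) : PadicInt.toZMod (digitChart a y) = a := by
  simp [digitChart]

theorem norm_digitChart_sub_of_ne {a b : ZMod p} (hab : a ≠ b) (y z : ℤ_[p]) :
    ‖digitChart a y - digitChart b z‖ = 1 := by
  by_contra h
  have h1 := lt_of_le_of_ne (PadicInt.norm_le_one _) h
  rw [← PadicInt.mem_nonunits, ← IsLocalRing.mem_maximalIdeal, ← PadicInt.ker_toZMod,
    RingHom.mem_ker, map_sub, toZMod_digitChart, toZMod_digitChart, sub_eq_zero] at h1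
  exact hab h1

theorem norm_digitChart_sub_self (a : ZMod p) (y z : ℤ_[p]) :
    ‖digitChart a y - digitChart a z‖ = (p : ℝ)⁻¹ * ‖y - z‖ := by
  rw [digitChart, digitChart, add_sub_add_left_eq_sub, ← mul_sub, norm_mul, PadicInt.norm_p]

/-- The index `⊥` behaves like an ordinary one whose digit is always `0`, since `0 = 0 + p * 0`. -/
theorem extendZero_digitChart (f : τ → ZMod p) (y : τ → ℤ_[p]) (k : WithBot τ) :
    extendZero (fun i => digitChart (f i) (y i)) k = digitChart (extendZero f k) (extendZero y k) := by
  cases k with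
  | bot => simp [extendZero, digitChart]
  | coe i => rfl

theorem pairsIn_eq_empty {I : Finset (WithBot τ)} (hI : I.card ≤ 1) : pairsIn I = ∅ := by
  rw [Finset.eq_empty_iff_forall_notMem]
  intro q hq
  rw [mem_pairsIn] at hq
  exact hq.2.ne (Finset.card_le_one.1 hI _ hq.1.1 _ hq.1.2)

/-- A pair lies in exactly one fibre if its digits agree, and in none otherwise. -/
theorem prod_pairsIn_fibre {M : Type*} [CommMonoid M] (f : τ → ZMod p) (I : Finset (WithBot τ))
    (g : WithBot τ × WithBot τ → M) :
    ∏ a, ∏ q ∈ pairsIn (fibre f I a), g q =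
      ∏ q ∈ pairsIn I, if extendZero f q.1 = extendZero f q.2 then g q else 1 := by
  have h : ∀ a, ∏ q ∈ pairsIn (fibre f I a), g q = ∏ q ∈ pairsIn I,
      if extendZero f q.1 = a then if extendZero f q.2 = a then g q else 1 else 1 := by
    intro a
    rw [← Finset.prod_filter_mul_prod_filter_not (pairsIn I)
      (fun q => extendZero f q.1 = a ∧ extendZero f q.2 = a)]
    have e : (pairsIn I).filter (fun q => extendZero f q.1 = a ∧ extendZero f q.2 = a) =
        pairsIn (fibre f I a) := by
      ext q
      simp only [Finset.mem_filter, mem_pairsIn, fibre]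
      tauto
    rw [e, Finset.prod_eq_one (s := Finset.filter (fun q => ¬_) _), mul_one]
    · refine Finset.prod_congr rfl fun q hq => ?_
      rw [← e, Finset.mem_filter] at hq
      rw [if_pos hq.2.1, if_pos hq.2.2]
    · intro q hq
      rw [Finset.mem_filter] at hq
      split_ifs with h1 h2
      · exact absurd ⟨h1, h2⟩ hq.2
      · rfl
      · rfl
  simp only [h]
  rw [Finset.prod_comm]
  refine Finset.prod_congr rfl fun q _ => ?_
  rw [Finset.prod_ite_eq]
  simp only [Finset.mem_univ, if_true, eq_comm]

/-- In the chart of the digits `f`, the cluster splits into the clusters of equal digits. -/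
theorem cluster_digitChart (w : WithBot τ × WithBot τ → ℂ) (I : Finset (WithBot τ))
    (f : τ → ZMod p) (y : τ → ℤ_[p]) :
    cluster w I (fun i => digitChart (f i) (y i)) =
      ∏ a, (p : ℂ) ^ (-weightSum w (fibre f I a)) * cluster w (fibre f I a) y := by
  have hp0 : (p : ℝ)⁻¹ ≠ 0 := inv_ne_zero (by exact_mod_cast hp.out.ne_zero)
  have h : ∀ a, (p : ℂ) ^ (-weightSum w (fibre f I a)) * cluster w (fibre f I a) y =
      ∏ q ∈ pairsIn (fibre f I a),
        cpw (p : ℝ)⁻¹ (w q) * cpw ‖extendZero y q.1 - extendZero y q.2‖ (w q) := by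
    intro a
    rw [Finset.prod_mul_distrib, ← cpw_sum hp0, cpw_inv_natCast p hp.out.ne_zero]
    rfl
  simp only [h]
  rw [prod_pairsIn_fibre]
  refine Finset.prod_congr rfl fun q _ => ?_
  rw [extendZero_digitChart, extendZero_digitChart]
  split_ifs with hq
  · rw [hq, norm_digitChart_sub_self, cpw_mul (by positivity) (norm_nonneg _)]
  · rw [norm_digitChart_sub_of_ne hq, cpw_one]

theorem measurable_extendZero (k : WithBot τ) :
    Measurable fun y : τ → ℤ_[p] => extendZero y k := by
  cases k with
  | bot => exact measurable_const
  | coe i => exact measurable_pi_apply i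

theorem measurable_norm_extendZero_sub (k l : WithBot τ) :
    Measurable fun y : τ → ℤ_[p] => ‖extendZero y k - extendZero y l‖ :=
  ((measurable_extendZero k).sub (measurable_extendZero l)).norm

theorem measurable_cluster (w : WithBot τ × WithBot τ → ℂ) (I : Finset (WithBot τ)) :
    Measurable (cluster (p := p) w I) :=
  Finset.measurable_fun_prod _ fun q _ =>
    (measurable_cpw (w q)).comp (measurable_norm_extendZero_sub q.1 q.2)

/-- The ordinary indices in `I`. -/
def ordinary (I : Finset (WithBot τ)) : Finset τ := Finset.univ.filter fun i : τ => (i : WithBot τ) ∈ I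

theorem dependsOn_cluster (w : WithBot τ × WithBot τ → ℂ) (I : Finset (WithBot τ)) :
    DependsOn (cluster (p := p) w I) (ordinary I : Set τ) := by
  intro y y' h
  have h' : ∀ k ∈ I, extendZero y k = extendZero y' k := by
    intro k hk
    cases k with
    | bot => rfl
    | coe i => exact h i (by simpa [ordinary] using hk)
  refine Finset.prod_congr rfl fun q hq => ?_
  rw [mem_pairsIn] at hq
  rw [h' _ hq.1.1, h' _ hq.1.2]

theorem disjoint_ordinary_fibre (f : τ → ZMod p) (I : Finset (WithBot τ)) (a b : ZMod p)
    (hab : a ≠ b) : Disjoint (ordinary (fibre f I a)) (ordinary (fibre f I b)) := by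
  rw [Finset.disjoint_left]
  intro i hi hj
  simp only [ordinary, fibre, Finset.mem_filter, Finset.mem_univ, true_and] at hi hj
  exact hab (hi.2.symm.trans hj.2)

/-- The digits `f` are constant on `I`. -/
def ConstOn (f : τ → ZMod p) (I : Finset (WithBot τ)) : Prop :=
  ∀ k ∈ I, ∀ l ∈ I, extendZero f k = extendZero f l

instance decidableConstOn (f : τ → ZMod p) (I : Finset (WithBot τ)) : Decidable (ConstOn f I) := by
  unfold ConstOn; infer_instance

/-! ### Counting the digit families that are constant on a set -/

theorem card_ordinary (I : Finset (WithBot τ)) :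
    I.card = (if ⊥ ∈ I then 1 else 0) + (ordinary I).card := by
  have h : I.erase ⊥ = (ordinary I).map ⟨WithBot.some, WithBot.coe_injective⟩ := by
    ext k
    cases k with
    | bot => simp
    | coe i => simp [ordinary]
  have h2 := congrArg Finset.card h
  rw [Finset.card_map] at h2
  rw [← h2]
  split_ifs with hb
  · rw [add_comm, Finset.card_erase_add_one hb]
  · rw [Finset.erase_eq_of_notMem hb, zero_add]

theorem card_piFinset_const (I : Finset (WithBot τ)) (a : ZMod p) :
    (Fintype.piFinset fun i : τ => if (i : WithBot τ) ∈ I then {a} else Finset.univ).card *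
      p ^ (ordinary I).card = p ^ Fintype.card τ := by
  rw [Fintype.card_piFinset, ordinary, ← Finset.prod_const, Finset.prod_filter,
    ← Finset.prod_mul_distrib, ← Finset.card_univ, ← Finset.prod_const]
  refine Finset.prod_congr rfl fun i _ => ?_
  split_ifs <;> simp [ZMod.card]

/-- The number of digit families which are constant on `I`. -/
theorem card_constOn {I : Finset (WithBot τ)} (hI : I.Nonempty) :
    (Finset.univ.filter fun f : τ → ZMod p => ConstOn f I).card * p ^ (I.card - 1) =
      p ^ Fintype.card τ := by
  have hcard := card_ordinary I
  -- If `⊥ ∈ I`, the common digit is forced to be `0`, and `|I| - 1` ordinary digits are fixed.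
  -- Otherwise `|I|` digits are fixed, but the common value is free among `p`. The exponent is `|I|
  -- - 1` in both cases.
  by_cases hb : ⊥ ∈ I
  · rw [if_pos hb] at hcard
    rw [hcard, Nat.add_sub_cancel_left, ← card_piFinset_const I 0]
    congr 2
    ext f
    simp only [Finset.mem_filter, Finset.mem_univ, true_and, Fintype.mem_piFinset]
    constructor
    · intro h i
      split_ifs with hi
      · exact Finset.mem_singleton.2 (h i hi ⊥ hb)
      · exact Finset.mem_univ _
    · intro h
      have h0 : ∀ k ∈ I, extendZero f k = 0 := by
        intro k hk
        cases k with
        | bot => rfl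
        | coe i => simpa [hk, extendZero] using h i
      intro k hk l hl
      rw [h0 k hk, h0 l hl]
  · rw [if_neg hb, zero_add] at hcard
    obtain ⟨k, hk⟩ := hI
    obtain ⟨i₀, rfl⟩ : ∃ i : τ, (i : WithBot τ) = k := by
      cases k with
      | bot => exact absurd hk hb
      | coe i => exact ⟨i, rfl⟩
    have hset : (Finset.univ.filter fun f : τ → ZMod p => ConstOn f I) =
        Finset.univ.biUnion fun a : ZMod p =>
          Fintype.piFinset fun i : τ => if (i : WithBot τ) ∈ I then {a} else Finset.univ := by
      ext f
      simp only [Finset.mem_filter, Finset.mem_univ, true_and, Finset.mem_biUnion,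
        Fintype.mem_piFinset]
      constructor
      · intro h
        refine ⟨f i₀, fun i => ?_⟩
        split_ifs with hi
        · exact Finset.mem_singleton.2 (h i hi i₀ hk)
        · exact Finset.mem_univ _
      · rintro ⟨a, h⟩
        have h0 : ∀ k ∈ I, extendZero f k = a := by
          intro k hk
          cases k with
          | bot => exact absurd hk hb
          | coe i => simpa [hk, extendZero] using h i
        intro k hk l hl
        rw [h0 k hk, h0 l hl]
    have hpos : 1 ≤ I.card := Finset.card_pos.2 ⟨_, hk⟩
    rw [hset, Finset.card_biUnion]
    · rw [Finset.sum_mul, ← card_piFinset_const I 0]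
      have hX : ∀ a : ZMod p, (Fintype.piFinset fun i : τ =>
          if (i : WithBot τ) ∈ I then {a} else Finset.univ).card = (Fintype.piFinset fun i : τ =>
          if (i : WithBot τ) ∈ I then {(0 : ZMod p)} else Finset.univ).card := by
        intro a
        rw [Fintype.card_piFinset, Fintype.card_piFinset]
        refine Finset.prod_congr rfl fun i _ => ?_
        split_ifs <;> rfl
      rw [Finset.sum_congr rfl fun a _ => by rw [hX a], Finset.sum_const, Finset.card_univ,
        ZMod.card, smul_eq_mul, ← hcard, mul_left_comm, ← pow_succ', Nat.sub_add_cancel hpos]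
    · intro a _ b _ hab
      rw [Function.onFun, Finset.disjoint_left]
      intro f hfa hfb
      rw [Fintype.mem_piFinset] at hfa hfb
      have ha := hfa i₀
      have hb' := hfb i₀
      rw [if_pos hk, Finset.mem_singleton] at ha hb'
      exact hab (ha.symm.trans hb')

theorem fibre_eq_self_of_constOn {f : τ → ZMod p} {I : Finset (WithBot τ)} (h : ConstOn f I)
    {k : WithBot τ} (hk : k ∈ I) : fibre f I (extendZero f k) = I :=
  Finset.filter_true_of_mem fun l hl => h l hl k hk

theorem fibre_eq_empty_of_constOn {f : τ → ZMod p} {I : Finset (WithBot τ)} (h : ConstOn f I)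
    {k : WithBot τ} (hk : k ∈ I) {a : ZMod p} (ha : a ≠ extendZero f k) : fibre f I a = ∅ :=
  Finset.filter_false_of_mem fun l hl hla => ha (hla.symm.trans (h l hl k hk))

theorem fibre_ssubset_of_not_constOn {f : τ → ZMod p} {I : Finset (WithBot τ)} (h : ¬ConstOn f I)
    (a : ZMod p) : fibre f I a ⊂ I := by
  refine (Finset.filter_subset _ _).ssubset_of_ne fun he => h fun k hk l hl => ?_
  have he := Finset.filter_eq_self.1 he
  rw [he k hk, he l hl]

/-- One fibre is all of `I`; the others are empty and drop out by `hg`. -/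
theorem prod_fibre_of_constOn {M : Type*} [CommMonoid M] {f : τ → ZMod p} {I : Finset (WithBot τ)}
    (h : ConstOn f I) (hI : I.Nonempty) {g : Finset (WithBot τ) → M} (hg : g ∅ = 1) :
    ∏ a, g (fibre f I a) = g I := by
  obtain ⟨k, hk⟩ := hI
  rw [Finset.prod_eq_single (extendZero f k), fibre_eq_self_of_constOn h hk]
  · intro a _ ha
    rw [fibre_eq_empty_of_constOn h hk ha, hg]
  · simp

theorem cluster_of_card_le_one (w : WithBot τ × WithBot τ → ℂ) {I : Finset (WithBot τ)}
    (hI : I.card ≤ 1) (y : τ → ℤ_[p]) : cluster w I y = 1 := by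
  rw [cluster, pairsIn_eq_empty hI, Finset.prod_empty]

theorem weightSum_of_card_le_one (w : WithBot τ × WithBot τ → ℂ) {I : Finset (WithBot τ)}
    (hI : I.card ≤ 1) : weightSum w I = 0 := by
  rw [weightSum, pairsIn_eq_empty hI, Finset.sum_empty]

theorem lintegral_haarPi {G : (τ → ℤ_[p]) → ℝ≥0∞} (hG : Measurable G) :
    ∫⁻ y, G y ∂haarPi p τ = ∑ f : τ → ZMod p,
      (p : ℝ≥0∞)⁻¹ ^ Fintype.card τ * ∫⁻ y, G (fun i => digitChart (f i) (y i)) ∂haarPi p τ := by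
  have hpn : (p : ℝ≥0) ≠ 0 := by exact_mod_cast hp.out.ne_zero
  rw [haarPi, lintegral_pi_eq_sum_chart (ρ := fun _ _ => (p : ℝ≥0)⁻¹) measurable_digitChart
    (fun _ => measurable_const) haarZp_eq_sum hG]
  refine Finset.sum_congr rfl fun f _ => ?_
  have hm : Measurable fun y : τ → ℤ_[p] => G fun i => digitChart (f i) (y i) :=
    hG.comp (measurable_pi_chart measurable_digitChart f)
  rw [lintegral_const_mul _ hm, Finset.prod_const, Finset.card_univ, ENNReal.coe_pow, ENNReal.coe_inv hpn, ENNReal.coe_natCast]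

theorem enorm_finset_prod {κ : Type*} (s : Finset κ) (g : κ → ℂ) :
    ‖∏ a ∈ s, g a‖ₑ = ∏ a ∈ s, ‖g a‖ₑ := by
  simp only [enorm_eq_nnnorm, nnnorm_prod, ENNReal.ofNNReal_finsetProd]

/-- The ratio of the geometric series attached to `I`. -/
def ratio (p : ℕ) (w : WithBot τ × WithBot τ → ℂ) (I : Finset (WithBot τ)) : ℂ :=
  (p : ℂ) ^ (-((I.card : ℂ) - 1 + weightSum w I))

/-- This is the total coefficient with which the cluster integral over `I` reappears in its own
digit expansion. By `card_constOn` the count contributes `p ^ (n - (|I| - 1))`, where `n` is the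
number of coordinates, and the chart volume contributes `p ^ (-n)`. -/
theorem constOn_smul_eq_ratio (w : WithBot τ × WithBot τ → ℂ) {I : Finset (WithBot τ)}
    (hI : I.Nonempty) :
    ((Finset.univ.filter fun f : τ → ZMod p => ConstOn f I).card : ℂ) *
      ((p : ℂ)⁻¹ ^ Fintype.card τ * (p : ℂ) ^ (-weightSum w I)) = ratio p w I := by
  have hp0 : (p : ℂ) ≠ 0 := by exact_mod_cast hp.out.ne_zero
  have h : ((Finset.univ.filter fun f : τ → ZMod p => ConstOn f I).card : ℂ) *
      (p : ℂ) ^ (I.card - 1) = (p : ℂ) ^ Fintype.card τ := by exact_mod_cast card_constOn hI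
  have h1 : (I.card : ℂ) - 1 = ((I.card - 1 : ℕ) : ℂ) := by
    rw [Nat.cast_sub (Finset.card_pos.2 hI)]; simp
  rw [ratio, neg_add, Complex.cpow_add _ _ hp0, h1, Complex.cpow_neg (p : ℂ) ((I.card - 1 : ℕ) : ℂ), Complex.cpow_natCast,
    ← mul_assoc]
  congr 1
  rw [inv_pow, ← h]
  have hc : ((Finset.univ.filter fun f : τ → ZMod p => ConstOn f I).card : ℂ) ≠ 0 := by
    intro h0
    rw [h0, zero_mul] at h
    exact pow_ne_zero _ hp0 h.symm
  field_simp

theorem enorm_natCast_inv_pow (n : ℕ) : ‖((p : ℂ)⁻¹ ^ n)‖ₑ = (p : ℝ≥0∞)⁻¹ ^ n := by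
  rw [enorm_pow, enorm_eq_nnnorm, nnnorm_inv, ENNReal.coe_inv (by simpa using hp.out.ne_zero)]
  simp

theorem norm_ratio_lt_one {w : WithBot τ × WithBot τ → ℂ} {I : Finset (WithBot τ)}
    (h : 0 < (I.card : ℝ) - 1 + (weightSum w I).re) : ‖ratio p w I‖ < 1 := by
  have hp1 : (1 : ℝ) < p := by exact_mod_cast hp.out.one_lt
  rw [ratio, Complex.norm_natCast_cpow_of_pos hp.out.pos]
  refine Real.rpow_lt_one_of_one_lt_of_neg hp1 ?_
  simp only [Complex.neg_re, Complex.add_re, Complex.sub_re, Complex.natCast_re, Complex.one_re]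
  linarith

/-! ### Truncation and convergence of cluster integrals -/

/-- The complement of the set of points with all coordinates in `I` congruent modulo `p ^ n`. -/
def separated (I : Finset (WithBot τ)) (n : ℕ) : Set (τ → ℤ_[p]) :=
  {y | ∃ k ∈ I, ∃ l ∈ I, ((p : ℝ)⁻¹) ^ n < ‖extendZero y k - extendZero y l‖}

theorem measurableSet_separated (I : Finset (WithBot τ)) (n : ℕ) :
    MeasurableSet (separated (p := p) I n) := by
  have : separated (p := p) I n = ⋃ k ∈ I, ⋃ l ∈ I,
      {y | ((p : ℝ)⁻¹) ^ n < ‖extendZero y k - extendZero y l‖} := by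
    ext y; simp [separated]
  rw [this]
  refine Finset.measurableSet_biUnion _ fun k _ => Finset.measurableSet_biUnion _ fun l _ => ?_
  exact measurableSet_lt measurable_const (measurable_norm_extendZero_sub k l)

/-- A common digit chart contracts distances by `p⁻¹`, so it shifts the truncation level by one. -/
theorem digitChart_mem_separated {f : τ → ZMod p} {I : Finset (WithBot τ)} (h : ConstOn f I)
    (n : ℕ) (y : τ → ℤ_[p]) :
    (fun i => digitChart (f i) (y i)) ∈ separated I (n + 1) ↔ y ∈ separated I n := by
  have hp0 : (0 : ℝ) < (p : ℝ)⁻¹ := inv_pos.2 (by exact_mod_cast hp.out.pos)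
  have key : ∀ k ∈ I, ∀ l ∈ I, ((p : ℝ)⁻¹ ^ (n + 1) <
      ‖extendZero (fun i => digitChart (f i) (y i)) k -
        extendZero (fun i => digitChart (f i) (y i)) l‖ ↔
      (p : ℝ)⁻¹ ^ n < ‖extendZero y k - extendZero y l‖) := by
    intro k hk l hl
    rw [extendZero_digitChart, extendZero_digitChart, h k hk l hl, norm_digitChart_sub_self,
      pow_succ', mul_lt_mul_iff_right₀ hp0]
  constructor
  · rintro ⟨k, hk, l, hl, hkl⟩
    exact ⟨k, hk, l, hl, (key k hk l hl).1 hkl⟩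
  · rintro ⟨k, hk, l, hl, hkl⟩
    exact ⟨k, hk, l, hl, (key k hk l hl).2 hkl⟩

theorem separated_zero (I : Finset (WithBot τ)) : separated (p := p) I 0 = ∅ := by
  rw [Set.eq_empty_iff_forall_notMem]
  rintro y ⟨k, _, l, _, h⟩
  rw [pow_zero] at h
  exact h.not_ge (PadicInt.norm_le_one _)

theorem monotone_separated (I : Finset (WithBot τ)) : Monotone (separated (p := p) I) := by
  rintro m n hmn y ⟨k, hk, l, hl, h⟩
  refine ⟨k, hk, l, hl, lt_of_le_of_lt (pow_le_pow_of_le_one (by positivity) ?_ hmn) h⟩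
  exact inv_le_one_of_one_le₀ (by exact_mod_cast hp.out.one_lt.le)

/-- Outside all truncations the coordinates in `I` coincide, and then any pair gives a factor `cpw 0
_ = 0`. Thus the truncations exhaust the support. -/
theorem cluster_eq_zero_of_notMem (w : WithBot τ × WithBot τ → ℂ) {I : Finset (WithBot τ)}
    (hI : 2 ≤ I.card) {y : τ → ℤ_[p]} (hy : ∀ n, y ∉ separated I n) : cluster w I y = 0 := by
  obtain ⟨k, hk, l, hl, hkl⟩ := Finset.one_lt_card.1 hI
  wlog hlt : k < l generalizing k l
  · exact this l hl k hk hkl.symm (lt_of_le_of_ne (not_lt.1 hlt) hkl.symm)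
  refine Finset.prod_eq_zero (i := (k, l)) (mem_pairsIn.2 ⟨⟨hk, hl⟩, hlt⟩) ?_
  have : ‖extendZero y k - extendZero y l‖ = 0 := by
    by_contra h0
    have hpos := lt_of_le_of_ne (norm_nonneg _) (Ne.symm h0)
    obtain ⟨n, hn⟩ := exists_pow_lt_of_lt_one hpos
      (inv_lt_one_of_one_lt₀ (by exact_mod_cast hp.out.one_lt : (1 : ℝ) < p))
    exact hy n ⟨k, hk, l, hl, hn⟩
  rw [this, cpw_zero]

/-- The digit recursion for the full integral of the norm would also be satisfied by `∞`. The
truncated integrals `E n` start at `0` and obey `E (n + 1) ≤ r * E n + C` with `r < 1`, so they stay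
bounded, and monotone convergence finishes. The constant `C` is finite by induction on `I`. -/
theorem integrable_cluster {w : WithBot τ × WithBot τ → ℂ}
    (hw : ∀ I : Finset (WithBot τ), 2 ≤ I.card → 0 < (I.card : ℝ) - 1 + (weightSum w I).re)
    (I : Finset (WithBot τ)) : Integrable (cluster w I) (haarPi p τ) := by
  induction I using Finset.strongInduction with
  | H I ih =>
  rcases Nat.lt_or_ge I.card 2 with hI | hI
  · have : cluster (p := p) w I = fun _ => 1 := by
      funext y; exact cluster_of_card_le_one w (by omega) y
    rw [this]
    exact integrable_const _
  have hne : I.Nonempty := Finset.card_pos.1 (by omega)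
  refine ⟨(measurable_cluster w I).aestronglyMeasurable, ?_⟩
  rw [hasFiniteIntegral_iff_enorm]
  set c : ℝ≥0∞ := (p : ℝ≥0∞)⁻¹ ^ Fintype.card τ with hc
  set E : ℕ → ℝ≥0∞ := fun n =>
    ∫⁻ y, (separated I n).indicator (fun y => ‖cluster w I y‖ₑ) y ∂haarPi p τ with hE
  have hmE : ∀ n, Measurable ((separated (p := p) I n).indicator fun y => ‖cluster w I y‖ₑ) :=
    fun n => (measurable_cluster w I).enorm.indicator (measurableSet_separated I n)
  -- The contribution of the non-constant digit families, which involve only strictly smaller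
  -- clusters; the truncation is simply dropped here.
  set C : ℝ≥0∞ := ∑ f : τ → ZMod p with ¬ConstOn f I,
    c * ∫⁻ y, ‖cluster w I (fun i => digitChart (f i) (y i))‖ₑ ∂haarPi p τ with hC
  have hCtop : C < ∞ := by
    refine ENNReal.sum_lt_top.2 fun f hf => ENNReal.mul_lt_top ?_ ?_
    · exact ENNReal.pow_lt_top (ENNReal.inv_lt_top.2 (by exact_mod_cast hp.out.pos))
    · have hint := integrable_prod_of_dependsOn (μ := haarZp p) Finset.univ
        (disjoint_ordinary_fibre f I)
        (g := fun a y => (p : ℂ) ^ (-weightSum w (fibre f I a)) * cluster w (fibre f I a) y)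
        (fun a => (measurable_cluster w _).const_mul _)
        (fun a y y' h => by simp only [dependsOn_cluster w (fibre f I a) h])
        (fun a _ => (ih _ (fibre_ssubset_of_not_constOn (Finset.mem_filter.1 hf).2 a)).const_mul _)
      have := hint.2
      rw [hasFiniteIntegral_iff_enorm] at this
      simpa only [cluster_digitChart] using this
  have hrec : ∀ n, E (n + 1) ≤ ‖ratio p w I‖ₑ * E n + C := by
    intro n
    have e1 : E (n + 1) = ∑ f : τ → ZMod p, c * ∫⁻ y, (separated I (n + 1)).indicator
        (fun y => ‖cluster w I y‖ₑ) (fun i => digitChart (f i) (y i)) ∂haarPi p τ :=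
      lintegral_haarPi (hmE (n + 1))
    rw [e1, ← Finset.sum_filter_add_sum_filter_not Finset.univ fun f => ConstOn f I]
    refine add_le_add ?_ (Finset.sum_le_sum fun f _ => ?_)
    · have e2 : ∀ f ∈ Finset.univ.filter (fun f : τ → ZMod p => ConstOn f I),
          c * ∫⁻ y, (separated I (n + 1)).indicator
            (fun y => ‖cluster w I y‖ₑ) (fun i => digitChart (f i) (y i)) ∂haarPi p τ =
          c * (‖(p : ℂ) ^ (-weightSum w I)‖ₑ * E n) := by
        intro f hf
        have hf := (Finset.mem_filter.1 hf).2
        rw [hE, ← lintegral_const_mul _ (hmE n)]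
        congr 1
        refine lintegral_congr fun y => ?_
        by_cases hy : y ∈ separated I n
        · rw [Set.indicator_of_mem hy,
            Set.indicator_of_mem ((digitChart_mem_separated hf n y).2 hy), cluster_digitChart,
            prod_fibre_of_constOn hf hne (g := fun J => (p : ℂ) ^ (-weightSum w J) * cluster w J y),
            enorm_mul]
          rw [weightSum_of_card_le_one w (by simp), cluster_of_card_le_one w (by simp)]
          simp
        · rw [Set.indicator_of_notMem hy,
            Set.indicator_of_notMem (fun h => hy ((digitChart_mem_separated hf n y).1 h)), mul_zero]
      rw [Finset.sum_congr rfl e2, Finset.sum_const, ← constOn_smul_eq_ratio w hne, enorm_mul,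
        enorm_mul, enorm_natCast_inv_pow, nsmul_eq_mul, ← hc]
      refine le_of_eq ?_
      rw [← mul_assoc, ← mul_assoc, ← mul_assoc]
      congr 3
      simp [enorm_eq_nnnorm]
    · gcongr with y
      exact Set.indicator_le_self _ _ _
  have hq : ‖ratio p w I‖ₑ < 1 := by
    rw [← ofReal_norm, ENNReal.ofReal_lt_one]
    exact norm_ratio_lt_one (hw I hI)
  -- The fixed point of `t ↦ r * t + C`, which bounds every iterate started at `0`.
  set B : ℝ≥0∞ := (1 - ‖ratio p w I‖ₑ)⁻¹ * C with hB
  have hBtop : B < ∞ := ENNReal.mul_lt_top (ENNReal.inv_lt_top.2 (tsub_pos_of_lt hq)) hCtop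
  have hBeq : ‖ratio p w I‖ₑ * B + C = B := by
    have h1 : (1 - ‖ratio p w I‖ₑ) * B = C := by
      rw [hB, ← mul_assoc, ENNReal.mul_inv_cancel (tsub_pos_of_lt hq).ne'
        (ENNReal.sub_ne_top ENNReal.one_ne_top), one_mul]
    conv_lhs => rw [← h1]
    rw [← add_mul, add_tsub_cancel_of_le hq.le, one_mul]
  have hbound : ∀ n, E n ≤ B := by
    intro n
    induction n with
    | zero => simp [hE, separated_zero]
    | succ n ihn =>
      refine ((hrec n).trans ?_).trans hBeq.le
      gcongr
  have hsup : ∫⁻ y, ‖cluster w I y‖ₑ ∂haarPi p τ = ⨆ n, E n := by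
    rw [hE, ← lintegral_iSup hmE]
    · refine lintegral_congr fun y => ?_
      by_cases hy : ∃ n, y ∈ separated I n
      · obtain ⟨n, hn⟩ := hy
        refine le_antisymm ?_ (iSup_le fun m => Set.indicator_le_self _ _ _)
        refine le_iSup_of_le n ?_
        rw [Set.indicator_of_mem hn]
      · push Not at hy
        rw [cluster_eq_zero_of_notMem w hI hy]
        simp [hy]
    · intro m n hmn y
      exact Set.indicator_le_indicator_of_subset (monotone_separated I hmn) (fun _ => zero_le) y
  rw [hsup]
  exact (iSup_le hbound).trans_lt hBtop

/-! ### The recursion for cluster integrals -/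

theorem clusterIntegral_of_card_le_one (w : WithBot τ × WithBot τ → ℂ) {I : Finset (WithBot τ)}
    (hI : I.card ≤ 1) : clusterIntegral p w I = 1 := by
  simp only [clusterIntegral, cluster_of_card_le_one w hI, integral_const, probReal_univ, one_smul]

theorem clusterIntegral_eq_sum {w : WithBot τ × WithBot τ → ℂ}
    (hw : ∀ I : Finset (WithBot τ), 2 ≤ I.card → 0 < (I.card : ℝ) - 1 + (weightSum w I).re)
    (I : Finset (WithBot τ)) :
    clusterIntegral p w I = ∑ f : τ → ZMod p, (p : ℂ)⁻¹ ^ Fintype.card τ *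
      ∏ a, (p : ℂ) ^ (-weightSum w (fibre f I a)) * clusterIntegral p w (fibre f I a) := by
  have hint : ∀ f : τ → ZMod p, Integrable (fun y => ∏ a,
      (p : ℂ) ^ (-weightSum w (fibre f I a)) * cluster w (fibre f I a) y) (haarPi p τ) := fun f =>
    integrable_prod_of_dependsOn (μ := haarZp p) Finset.univ
      (disjoint_ordinary_fibre f I)
      (g := fun a y => (p : ℂ) ^ (-weightSum w (fibre f I a)) * cluster w (fibre f I a) y)
      (fun a => (measurable_cluster w _).const_mul _)
      (fun a y y' h => by simp only [dependsOn_cluster w (fibre f I a) h])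
      (fun a _ => (integrable_cluster hw _).const_mul _)
  have hc : ((∏ _i : τ, (p : ℝ≥0)⁻¹ : ℝ≥0) : ℂ) = (p : ℂ)⁻¹ ^ Fintype.card τ := by simp
  have h := (integrable_integral_pi_chart (ι := τ) (ρ := fun _ _ => (p : ℝ≥0)⁻¹)
    measurable_digitChart (fun _ => measurable_const) haarZp_eq_sum
    (measurable_cluster (p := p) w I) (fun f => by
      simp only [cluster_digitChart]
      exact (hint f).const_mul _)).2
  rw [clusterIntegral, h]
  refine Finset.sum_congr rfl fun f _ => ?_
  rw [integral_const_mul, hc]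
  simp only [cluster_digitChart]
  rw [integral_prod_of_dependsOn (μ := haarZp p) Finset.univ
    (disjoint_ordinary_fibre f I)
    (g := fun a y => (p : ℂ) ^ (-weightSum w (fibre f I a)) * cluster w (fibre f I a) y)
    (fun a => (measurable_cluster w _).const_mul _)
    (fun a y y' h => by simp only [dependsOn_cluster w (fibre f I a) h])]
  simp only [integral_const_mul, clusterIntegral]

/-- In the digit expansion the constant families contribute `ratio p w I` times the unknown. As the
ratio has norm below one, the linear equation can be solved, and only smaller clusters remain on the
right. -/
theorem clusterIntegral_eq {w : WithBot τ × WithBot τ → ℂ}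
    (hw : ∀ I : Finset (WithBot τ), 2 ≤ I.card → 0 < (I.card : ℝ) - 1 + (weightSum w I).re)
    {I : Finset (WithBot τ)} (hI : 2 ≤ I.card) :
    clusterIntegral p w I = (1 - ratio p w I)⁻¹ *
      ∑ f : τ → ZMod p with ¬ConstOn f I, (p : ℂ)⁻¹ ^ Fintype.card τ *
      ∏ a, (p : ℂ) ^ (-weightSum w (fibre f I a)) * clusterIntegral p w (fibre f I a) := by
  have hne : I.Nonempty := Finset.card_pos.1 (by omega)
  have hq : 1 - ratio p w I ≠ 0 := by
    intro h0
    have h1 := norm_ratio_lt_one (p := p) (hw I hI)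
    rw [← sub_eq_zero.1 h0, norm_one] at h1
    exact lt_irrefl _ h1
  have h := clusterIntegral_eq_sum (p := p) hw I
  rw [← Finset.sum_filter_add_sum_filter_not Finset.univ fun f => ConstOn f I] at h
  have e : ∀ f ∈ Finset.univ.filter (fun f : τ → ZMod p => ConstOn f I),
      (p : ℂ)⁻¹ ^ Fintype.card τ *
        ∏ a, (p : ℂ) ^ (-weightSum w (fibre f I a)) * clusterIntegral p w (fibre f I a) =
      (p : ℂ)⁻¹ ^ Fintype.card τ * ((p : ℂ) ^ (-weightSum w I) * clusterIntegral p w I) := by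
    intro f hf
    rw [prod_fibre_of_constOn (Finset.mem_filter.1 hf).2 hne
      (g := fun J => (p : ℂ) ^ (-weightSum w J) * clusterIntegral p w J)]
    rw [weightSum_of_card_le_one w (by simp), clusterIntegral_of_card_le_one w (by simp)]
    simp
  rw [Finset.sum_congr rfl e, Finset.sum_const, nsmul_eq_mul, ← mul_assoc, ← mul_assoc,
    mul_assoc (Nat.cast _), constOn_smul_eq_ratio w hne] at h
  rw [eq_inv_mul_iff_mul_eq₀ hq, sub_mul, one_mul, sub_eq_iff_eq_add']
  exact h

/-- Cluster integrals depend rationally on the parameters. -/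
theorem clusterIntegral_mem {S : Type*} (R : Subring (S → ℂ)) {w : S → WithBot τ × WithBot τ → ℂ}
    (hw : ∀ s, ∀ I : Finset (WithBot τ), 2 ≤ I.card →
      0 < (I.card : ℝ) - 1 + (weightSum (w s) I).re)
    (hp' : (fun _ => (p : ℂ)⁻¹) ∈ R)
    (hc : ∀ I, (fun s => (p : ℂ) ^ (-weightSum (w s) I)) ∈ R)
    (hr : ∀ I, 2 ≤ I.card → (fun s => (1 - ratio p (w s) I)⁻¹) ∈ R)
    (I : Finset (WithBot τ)) : (fun s => clusterIntegral p (w s) I) ∈ R := by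
  induction I using Finset.strongInduction with
  | H I ih =>
  rcases Nat.lt_or_ge I.card 2 with hI | hI
  · have : (fun s => clusterIntegral p (w s) I) = 1 := by
      funext s; exact clusterIntegral_of_card_le_one _ (by omega)
    rw [this]
    exact R.one_mem
  · have : (fun s => clusterIntegral p (w s) I) = (fun s => (1 - ratio p (w s) I)⁻¹) *
        ∑ f : τ → ZMod p with ¬ConstOn f I, (fun _ => (p : ℂ)⁻¹) ^ Fintype.card τ *
        ∏ a, (fun s => (p : ℂ) ^ (-weightSum (w s) (fibre f I a))) *
          (fun s => clusterIntegral p (w s) (fibre f I a)) := by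
      funext s
      rw [clusterIntegral_eq (hw s) hI]
      simp only [Pi.mul_apply, Finset.sum_apply, Finset.prod_apply, Pi.pow_apply]
    rw [this]
    refine R.mul_mem (hr I hI) (R.sum_mem fun f hf => R.mul_mem (R.pow_mem hp' _)
      (R.prod_mem fun a _ => R.mul_mem (hc _) (ih _ ?_)))
    exact fibre_ssubset_of_not_constOn (Finset.mem_filter.1 hf).2 a

end Cluster

/-! ### The integral as a finite sum of products of cluster integrals -/

section Charts

variable {p : ℕ} [hp : Fact p.Prime] {N : ℕ}

theorem prod_withBot {τ M : Type*} [Fintype τ] [CommMonoid M] (h : WithBot τ → M) :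
    ∏ k, h k = h ⊥ * ∏ i : τ, h i :=
  Fintype.prod_option h

/-- Products over the pairs in `I` in terms of the pairs of ordinary indices. -/
theorem prod_pairsIn {M : Type*} [CommMonoid M] (I : Finset (WithBot (T N)))
    (g : WithBot (T N) × WithBot (T N) → M) :
    ∏ q ∈ pairsIn I, g q = (if ⊥ ∈ I then ∏ i ∈ ordinary I, g (⊥, (i : WithBot (T N))) else 1) *
      ∏ q : Pairs N with q.1.1 ∈ ordinary I ∧ q.1.2 ∈ ordinary I, g (q.1.1, q.1.2) := by
  have e1 : ∏ q ∈ pairsIn I, g q = ∏ k, ∏ l, if (k ∈ I ∧ l ∈ I) ∧ k < l then g (k, l) else 1 := by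
    rw [← Fintype.prod_prod_type', ← Finset.prod_filter]
    refine Finset.prod_congr ?_ fun q _ => rfl
    ext q
    simp [mem_pairsIn]
  rw [e1, prod_withBot, prod_withBot]
  congr 1
  · simp only [lt_self_iff_false, and_false, if_false, one_mul, WithBot.bot_lt_coe, and_true]
    split_ifs with hb
    · rw [ordinary, Finset.prod_filter]
      exact Finset.prod_congr rfl fun i _ => by
        by_cases hi : (i : WithBot (T N)) ∈ I <;> simp [hi, hb]
    · simp [hb]
  · simp only [prod_withBot, not_lt_bot, and_false, if_false, one_mul, WithBot.coe_lt_coe]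
    rw [← Fintype.prod_prod_type' (f := fun i j : T N => if ((i : WithBot (T N)) ∈ I ∧
      (j : WithBot (T N)) ∈ I) ∧ i < j then g (i, j) else 1), Finset.prod_filter]
    rw [← Finset.prod_subtype (Finset.univ.filter fun q : T N × T N => q.1 < q.2)
      (fun q => by simp) (fun q : T N × T N => if q.1 ∈ ordinary I ∧ q.2 ∈ ordinary I then
        g ((q.1 : WithBot (T N)), (q.2 : WithBot (T N))) else 1), Finset.prod_filter]
    refine Finset.prod_congr rfl fun q _ => ?_
    by_cases h1 : q.1 < q.2 <;> simp [h1, ordinary]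

theorem sum_pairsIn {M : Type*} [AddCommMonoid M] (I : Finset (WithBot (T N)))
    (g : WithBot (T N) × WithBot (T N) → M) :
    ∑ q ∈ pairsIn I, g q = (if ⊥ ∈ I then ∑ i ∈ ordinary I, g (⊥, (i : WithBot (T N))) else 0) +
      ∑ q : Pairs N with q.1.1 ∈ ordinary I ∧ q.1.2 ∈ ordinary I, g (q.1.1, q.1.2) :=
  prod_pairsIn (M := Multiplicative M) I g

/-- The residue classes of `0`, `1` and `∞`. -/
def Marked (a : Option (ZMod p)) : Prop := a = none ∨ a = some 0 ∨ a = some 1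

instance decidableMarked (a : Option (ZMod p)) : Decidable (Marked a) := by
  unfold Marked; infer_instance

/-- The exponent of the distance to the point `0`, `1` or `∞` in its residue class. -/
def markWeight (a : Option (ZMod p)) (s : Idx N → ℂ) (i : T N) : ℂ :=
  match a with
  -- At infinity every distance that involves `x_i` contributes `|p y_i|⁻¹`, which explains the sign
  -- and the sum over all exponents involving `i`; the `2` comes from the density.
  | none => -(2 + c1 s i + cLast s i + (∑ q : Pairs N with q.1.1 = i, cPair s q) +
      ∑ q : Pairs N with q.1.2 = i, cPair s q)
  | some a => if a = 0 then c1 s i else cLast s i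

/-- The weights of the clusters in the residue class `a`. -/
def classWeight (a : Option (ZMod p)) (s : Idx N → ℂ) :
    WithBot (T N) × WithBot (T N) → ℂ
  | (⊥, (i : T N)) => markWeight a s i
  -- The two values `0` in this definition are defaults: `pairsIn` contains only increasing pairs.
  | ((i : T N), (j : T N)) => if h : i < j then cPair s ⟨(i, j), h⟩ else 0
  | (_, ⊥) => 0

theorem classWeight_pair (a : Option (ZMod p)) (s : Idx N → ℂ) (q : Pairs N) :
    classWeight a s ((q.1.1 : WithBot (T N)), (q.1.2 : WithBot (T N))) = cPair s q := by
  simp only [classWeight]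
  exact dif_pos q.2

theorem classWeight_bot (a : Option (ZMod p)) (s : Idx N → ℂ) (i : T N) :
    classWeight a s (⊥, (i : WithBot (T N))) = markWeight a s i := rfl

/-- The indices in the residue class `a`, with `⊥` for the point `0`, `1` or `∞`. -/
def classSet (f : T N → Option (ZMod p)) (a : Option (ZMod p)) : Finset (WithBot (T N)) :=
  (if Marked a then {⊥} else ∅) ∪
    (Finset.univ.filter fun i => f i = a).map ⟨WithBot.some, WithBot.coe_injective⟩

theorem bot_mem_classSet (f : T N → Option (ZMod p)) (a : Option (ZMod p)) :
    ⊥ ∈ classSet f a ↔ Marked a := by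
  by_cases h : Marked a <;> simp [classSet, h]

theorem coe_mem_classSet (f : T N → Option (ZMod p)) (a : Option (ZMod p)) (i : T N) :
    (i : WithBot (T N)) ∈ classSet f a ↔ f i = a := by
  by_cases h : Marked a <;> simp [classSet, h]

theorem mem_ordinary_classSet (f : T N → Option (ZMod p)) (a : Option (ZMod p)) (i : T N) :
    i ∈ ordinary (classSet f a) ↔ f i = a := by
  rw [ordinary, Finset.mem_filter, coe_mem_classSet]
  simp

theorem disjoint_ordinary_classSet (f : T N → Option (ZMod p)) (a b : Option (ZMod p))
    (hab : a ≠ b) : Disjoint (ordinary (classSet f a)) (ordinary (classSet f b)) := by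
  rw [Finset.disjoint_left]
  intro i hi hj
  rw [mem_ordinary_classSet] at hi hj
  exact hab (hi.symm.trans hj)

/-- The integrand, extended by `0` to the set `Lam`. -/
def integrandZero (s : Idx N → ℂ) (x : T N → ℚ_[p]) : ℂ :=
  (∏ i, cpw ‖x i‖ (c1 s i) * cpw ‖1 - x i‖ (cLast s i)) *
    ∏ q : Pairs N, cpw ‖x q.1.1 - x q.1.2‖ (cPair s q)

/-- On `Lam` some factor is `cpw 0 _ = 0`, whatever its exponent. Integrals over the complement thus
become integrals over the whole space, to which the charts apply. -/
theorem indicator_integrand (s : Idx N → ℂ) :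
    (Lam p N)ᶜ.indicator (integrand p s) = integrandZero s := by
  funext x
  by_cases hx : x ∈ Lam p N
  · rw [Set.indicator_of_notMem (by simpa using hx)]
    simp only [Lam, Set.mem_ofPred_eq, mul_eq_zero, Finset.prod_eq_zero_iff] at hx
    symm
    rcases hx with ⟨i, _, hi⟩ | ⟨q, _, hq⟩
    · refine mul_eq_zero_of_left (Finset.prod_eq_zero (Finset.mem_univ i) ?_) _
      rcases hi with hi | hi <;> simp [hi, cpw_zero]
    · refine mul_eq_zero_of_right _ (Finset.prod_eq_zero (Finset.mem_univ q) ?_)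
      simp [hq, cpw_zero]
  · rw [Set.indicator_of_mem (by simpa using hx)]
    simp only [Lam, Set.mem_ofPred_eq, mul_eq_zero, Finset.prod_eq_zero_iff, not_or, not_exists,
      Finset.mem_univ, true_and] at hx
    unfold integrand integrandZero
    congr 1
    · refine Finset.prod_congr rfl fun i _ => ?_
      rw [cpw_of_ne_zero (norm_ne_zero_iff.2 (hx.1 i).1),
        cpw_of_ne_zero (norm_ne_zero_iff.2 (hx.1 i).2)]
    · refine Finset.prod_congr rfl fun q _ => ?_
      rw [cpw_of_ne_zero (norm_ne_zero_iff.2 (hx.2 q))]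

theorem measurable_integrandZero (s : Idx N → ℂ) : Measurable (integrandZero (p := p) s) := by
  have h1 : ∀ i : T N, Measurable fun x : T N → ℚ_[p] => x i := measurable_pi_apply
  refine Measurable.mul (Finset.measurable_fun_prod _ fun i _ => Measurable.mul ?_ ?_)
    (Finset.measurable_fun_prod _ fun q _ => ?_)
  · exact (measurable_cpw _).comp (h1 i).norm
  · exact (measurable_cpw _).comp ((h1 i).const_sub 1).norm
  · exact (measurable_cpw _).comp ((h1 q.1.1).sub (h1 q.1.2)).norm

theorem measurableSet_Lam : MeasurableSet (Lam p N) := by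
  have h1 : ∀ i : T N, Measurable fun x : T N → ℚ_[p] => x i := measurable_pi_apply
  refine measurableSet_eq_fun (Measurable.mul (Finset.measurable_fun_prod _ fun i _ => ?_)
    (Finset.measurable_fun_prod _ fun q _ => ?_)) measurable_const
  · exact (h1 i).mul ((h1 i).const_sub 1)
  · exact (h1 q.1.1).sub (h1 q.1.2)

theorem norm_projChart_none (y : ℤ_[p]) : ‖projChart none y‖ = ((p : ℝ)⁻¹ * ‖y‖)⁻¹ := by
  simp [projChart]

theorem inv_mul_norm_lt_one (y : ℤ_[p]) : (p : ℝ)⁻¹ * ‖y‖ < 1 := by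
  have hp1 : (p : ℝ)⁻¹ < 1 := inv_lt_one_of_one_lt₀ (by exact_mod_cast hp.out.one_lt)
  have h0 : (0 : ℝ) ≤ (p : ℝ)⁻¹ := by positivity
  nlinarith [PadicInt.norm_le_one y, norm_nonneg y]

theorem inv_mul_norm_pos {y : ℤ_[p]} (hy : y ≠ 0) : 0 < (p : ℝ)⁻¹ * ‖y‖ := by
  have : (0 : ℝ) < (p : ℝ)⁻¹ := inv_pos.2 (by exact_mod_cast hp.out.pos)
  have := norm_pos_iff.2 hy
  positivity

/-- A point in the disc at infinity has norm above one, so it dominates every `p`-adic integer. -/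
theorem norm_projChart_none_sub {y : ℤ_[p]} (hy : y ≠ 0) {x : ℚ_[p]} (hx : ‖x‖ ≤ 1) :
    ‖projChart none y - x‖ = ((p : ℝ)⁻¹ * ‖y‖)⁻¹ := by
  have h1 : ‖x‖ < ‖projChart none y‖ := by
    rw [norm_projChart_none]
    exact hx.trans_lt ((one_lt_inv₀ (inv_mul_norm_pos hy)).2 (inv_mul_norm_lt_one y))
  rw [← norm_projChart_none, sub_eq_add_neg,
    Padic.add_eq_max_of_ne (by rw [norm_neg]; exact h1.ne'), norm_neg, max_eq_left h1.le]

theorem norm_projChart_some_le (a : ZMod p) (y : ℤ_[p]) : ‖projChart (some a) y‖ ≤ 1 :=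
  PadicInt.norm_le_one (digitChart a y)

theorem norm_projChart_some_sub (a b : ZMod p) (y z : ℤ_[p]) :
    ‖projChart (some a) y - projChart (some b) z‖ = ‖digitChart a y - digitChart b z‖ := by
  rw [PadicInt.norm_def]; simp [projChart]

theorem norm_projChart_none_sub_none {y z : ℤ_[p]} (hy : y ≠ 0) (hz : z ≠ 0) :
    ‖projChart none y - projChart none z‖ =
      ((p : ℝ)⁻¹ * ‖y - z‖) * ((p : ℝ)⁻¹ * ‖y‖)⁻¹ * ((p : ℝ)⁻¹ * ‖z‖)⁻¹ := by
  have hp0 := padic_natCast_self_ne_zero (p := p)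
  have hy' : (y : ℚ_[p]) ≠ 0 := by simpa using hy
  have hz' : (z : ℚ_[p]) ≠ 0 := by simpa using hz
  have h : projChart none y - projChart none z =
      -((p : ℚ_[p]) * ((y - z : ℤ_[p]) : ℚ_[p])) * (p * (y : ℚ_[p]))⁻¹ * (p * (z : ℚ_[p]))⁻¹ := by
    simp only [projChart]
    push_cast
    field_simp
    ring
  rw [h, norm_mul, norm_mul, norm_neg, norm_mul, norm_inv, norm_inv, norm_mul, norm_mul,
    Padic.norm_p]
  rfl

/-- The point `0` is the centre of its own digit chart, and `1` likewise below, so distances to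
marked points follow the rules for pairs of coordinates. -/
theorem norm_projChart_some_zero (a : ZMod p) (y : ℤ_[p]) :
    ‖projChart (some a) y‖ = ‖digitChart a y - digitChart 0 0‖ := by
  rw [← norm_projChart_some_sub]; simp [projChart, digitChart]

theorem norm_one_sub_projChart_some (a : ZMod p) (y : ℤ_[p]) :
    ‖1 - projChart (some a) y‖ = ‖digitChart a y - digitChart 1 0‖ := by
  have := Fact.mk hp.out.one_lt
  rw [← norm_projChart_some_sub, ← norm_neg]
  simp [projChart, digitChart, ZMod.val_one]

/-- The factor of a single index in the charts. -/
theorem density_mul_factor (s : Idx N → ℂ) (i : T N) (a : Option (ZMod p)) (y : ℤ_[p])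
    (hy : a = none → y ≠ 0) :
    (projDensity a y : ℂ) * (cpw ‖projChart a y‖ (c1 s i) * cpw ‖1 - projChart a y‖ (cLast s i)) *
      (if a = none then cpw ((p : ℝ)⁻¹ * ‖y‖)⁻¹ ((∑ q : Pairs N with q.1.1 = i, cPair s q) +
        ∑ q : Pairs N with q.1.2 = i, cPair s q) else 1) =
    (p : ℂ)⁻¹ * if Marked a then cpw ((p : ℝ)⁻¹ * ‖y‖) (markWeight a s i) else 1 := by
  have hp0 : (p : ℂ) ≠ 0 := by exact_mod_cast hp.out.ne_zero
  have h0 : (0 : ℝ) ≤ (p : ℝ)⁻¹ * ‖y‖ := by positivity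
  cases a with
  | none =>
    have hy := hy rfl
    have hu := inv_mul_norm_pos hy
    -- Rewriting `p |y|⁻²` as `p⁻¹ (p⁻¹ |y|)⁻²` leaves the same factor `p⁻¹` as in the finite discs.
    have hd : (projDensity (none : Option (ZMod p)) y : ℂ) =
        (p : ℂ)⁻¹ * cpw ((p : ℝ)⁻¹ * ‖y‖)⁻¹ 2 := by
      rw [cpw_of_ne_zero (inv_ne_zero hu.ne')]
      have : (2 : ℂ) = ((2 : ℕ) : ℂ) := by norm_num
      rw [this, Complex.cpow_natCast]
      simp only [projDensity]
      push_cast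
      rw [mul_inv, inv_inv]
      field_simp
    rw [if_pos rfl, if_pos (show Marked (none : Option (ZMod p)) from Or.inl rfl), hd, norm_projChart_none, norm_sub_rev,
      norm_projChart_none_sub hy (by simp), ← cpw_add, mul_assoc, mul_assoc, ← cpw_add, ← cpw_add,
      cpw_inv h0]
    congr 2
    simp only [markWeight]
    ring
  | some a =>
    have hd : (projDensity (some a) y : ℂ) = (p : ℂ)⁻¹ := by simp [projDensity]
    rw [hd, if_neg (by simp), mul_one, norm_projChart_some_zero, norm_one_sub_projChart_some]
    congr 1
    by_cases ha0 : a = 0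
    · subst ha0
      rw [if_pos (show Marked (some (0 : ZMod p)) from Or.inr (Or.inl rfl)), norm_digitChart_sub_self,
        norm_digitChart_sub_of_ne zero_ne_one, cpw_one, mul_one, sub_zero]
      simp [markWeight]
    by_cases ha1 : a = 1
    · subst ha1
      rw [if_pos (show Marked (some (1 : ZMod p)) from Or.inr (Or.inr rfl)), norm_digitChart_sub_self,
        norm_digitChart_sub_of_ne one_ne_zero, cpw_one, one_mul, sub_zero]
      simp [markWeight]
    · rw [if_neg (by simp [Marked, ha0, ha1]), norm_digitChart_sub_of_ne ha0,
        norm_digitChart_sub_of_ne ha1, cpw_one, cpw_one, one_mul]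

/-- The factor of a pair of indices in the charts. -/
theorem pair_factor (s : ℂ) (a b : Option (ZMod p)) (y z : ℤ_[p])
    (hy : a = none → y ≠ 0) (hz : b = none → z ≠ 0) :
    cpw ‖projChart a y - projChart b z‖ s =
      (if a = b then cpw ((p : ℝ)⁻¹ * ‖y - z‖) s else 1) *
      ((if a = none then cpw ((p : ℝ)⁻¹ * ‖y‖)⁻¹ s else 1) *
      (if b = none then cpw ((p : ℝ)⁻¹ * ‖z‖)⁻¹ s else 1)) := by
  cases a with
  | none =>
    cases b with
    | none =>
      rw [norm_projChart_none_sub_none (hy rfl) (hz rfl), cpw_mul (by positivity) (by positivity),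
        cpw_mul (by positivity) (by positivity)]
      simp [mul_assoc]
    | some b =>
      rw [norm_projChart_none_sub (hy rfl) (norm_projChart_some_le b z)]
      simp
  | some a =>
    cases b with
    | none =>
      rw [norm_sub_rev, norm_projChart_none_sub (hz rfl) (norm_projChart_some_le a y)]
      simp
    | some b =>
      rw [norm_projChart_some_sub]
      by_cases hab : a = b
      · subst hab
        rw [norm_digitChart_sub_self]
        simp
      · rw [norm_digitChart_sub_of_ne hab, cpw_one]
        simp [hab]

/-- In the charts the integrand splits into clusters, one for each residue class. -/
theorem integrandZero_projChart (s : Idx N → ℂ) (f : T N → Option (ZMod p)) (y : T N → ℤ_[p]) :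
    ((∏ i, projDensity (f i) (y i) : ℝ≥0) : ℂ) *
        integrandZero s (fun i => projChart (f i) (y i)) =
      ∏ a, (p : ℂ)⁻¹ ^ (ordinary (classSet f a)).card *
        (p : ℂ) ^ (-weightSum (classWeight a s) (classSet f a)) *
        cluster (classWeight a s) (classSet f a) y := by
  have hp0 : (p : ℝ)⁻¹ ≠ 0 := inv_ne_zero (by exact_mod_cast hp.out.ne_zero)
  -- At the point at infinity itself the convention `0⁻¹ = 0` spoils the norm identities, but both
  -- sides vanish: the density is `0`, and the pair `(⊥, i)` annihilates the cluster.
  by_cases hdeg : ∃ i, f i = none ∧ y i = 0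
  · obtain ⟨i, hi, hyi⟩ := hdeg
    have h1 : ∏ i, projDensity (f i) (y i) = 0 :=
      Finset.prod_eq_zero (Finset.mem_univ i) (by simp [hi, projDensity, hyi])
    have h2 : cluster (classWeight (none : Option (ZMod p)) s) (classSet f none) y = 0 := by
      have hb : ⊥ ∈ classSet f (none : Option (ZMod p)) := (bot_mem_classSet f none).2 (Or.inl rfl)
      have hi' : (i : WithBot (T N)) ∈ classSet f none := (coe_mem_classSet f none i).2 hi
      refine Finset.prod_eq_zero (i := (⊥, (i : WithBot (T N))))
        (mem_pairsIn.2 ⟨⟨hb, hi'⟩, WithBot.bot_lt_coe i⟩) ?_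
      have : ‖extendZero y ⊥ - extendZero y (i : WithBot (T N))‖ = 0 := by
        simp [extendZero, hyi]
      rw [this, cpw_zero]
    rw [h1, Finset.prod_eq_zero (Finset.mem_univ (none : Option (ZMod p))) (by rw [h2, mul_zero])]
    simp
  push Not at hdeg
  -- the clusters as products over indices and pairs
  have hR : ∀ a, (p : ℂ)⁻¹ ^ (ordinary (classSet f a)).card *
        (p : ℂ) ^ (-weightSum (classWeight a s) (classSet f a)) *
        cluster (classWeight a s) (classSet f a) y =
      (∏ i, if f i = a then (p : ℂ)⁻¹ * (if Marked (f i) then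
        cpw ((p : ℝ)⁻¹ * ‖y i‖) (markWeight (f i) s i) else 1) else 1) *
      ∏ q : Pairs N, if f q.1.1 = a then (if f q.1.1 = f q.1.2 then
        cpw ((p : ℝ)⁻¹ * ‖y q.1.1 - y q.1.2‖) (cPair s q) else 1) else 1 := by
    intro a
    have e1 : (p : ℂ) ^ (-weightSum (classWeight a s) (classSet f a)) *
        cluster (classWeight a s) (classSet f a) y = ∏ q ∈ pairsIn (classSet f a),
          cpw ((p : ℝ)⁻¹ * ‖extendZero y q.1 - extendZero y q.2‖) (classWeight a s q) := by
      rw [← cpw_inv_natCast p hp.out.ne_zero, weightSum, cpw_sum hp0, cluster,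
        ← Finset.prod_mul_distrib]
      refine Finset.prod_congr rfl fun q _ => ?_
      rw [cpw_mul (by positivity) (norm_nonneg _)]
    rw [mul_assoc, e1, prod_pairsIn, ← mul_assoc]
    have hord : ordinary (classSet f a) = Finset.univ.filter fun i => f i = a := by
      ext i; simp [mem_ordinary_classSet]
    congr 1
    · rw [hord, ← Finset.prod_const, ← Finset.prod_filter, Finset.prod_mul_distrib]
      congr 1
      have hbM := bot_mem_classSet f a
      by_cases hM : Marked a
      · rw [if_pos (hbM.2 hM)]
        refine Finset.prod_congr rfl fun i hi => ?_
        rw [(Finset.mem_filter.1 hi).2, if_pos hM, classWeight_bot]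
        simp [extendZero]
      · rw [if_neg (fun h => hM (hbM.1 h)), Finset.prod_eq_one]
        intro i hi
        rw [(Finset.mem_filter.1 hi).2, if_neg hM]
    · rw [Finset.prod_filter]
      refine Finset.prod_congr rfl fun q _ => ?_
      simp only [mem_ordinary_classSet]
      by_cases h1 : f q.1.1 = a
      · by_cases h2 : f q.1.2 = a
        · rw [if_pos ⟨h1, h2⟩, if_pos h1, if_pos (h1.trans h2.symm), classWeight_pair]
          rfl
        · rw [if_neg (fun h => h2 h.2), if_pos h1, if_neg (fun h => h2 (h.symm.trans h1))]
      · rw [if_neg (fun h => h1 h.1), if_neg h1]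
  simp only [hR]
  rw [Finset.prod_mul_distrib]
  -- Exchanging the products lets every index, and every pair through its first index, select its
  -- own class.
  refine Eq.trans ?_ (congrArg₂ (· * ·) Finset.prod_comm Finset.prod_comm).symm
  simp only [Finset.prod_ite_eq, Finset.mem_univ, if_true]
  -- the integrand
  simp only [integrandZero]
  have hV : ∀ q : Pairs N, cpw ‖projChart (f q.1.1) (y q.1.1) - projChart (f q.1.2) (y q.1.2)‖
      (cPair s q) = _ := fun q => pair_factor (cPair s q) (f q.1.1) (f q.1.2) (y q.1.1) (y q.1.2)
        (hdeg _) (hdeg _)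
  simp only [hV]
  simp only [Finset.prod_mul_distrib (s := (Finset.univ : Finset (Pairs N)))]
  -- The powers of `|p y_i|` produced by pairs are collected at the endpoint `i`, where they
  -- complete the exponent `markWeight`.
  have hswap : ∀ π : Pairs N → T N, ∏ q : Pairs N, (if f (π q) = none then
      cpw ((p : ℝ)⁻¹ * ‖y (π q)‖)⁻¹ (cPair s q) else 1) = ∏ i, if f i = none then
      cpw ((p : ℝ)⁻¹ * ‖y i‖)⁻¹ (∑ q : Pairs N with π q = i, cPair s q) else 1 := by
    intro π
    rw [← Finset.prod_fiberwise Finset.univ π]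
    refine Finset.prod_congr rfl fun i _ => ?_
    by_cases hi : f i = none
    · rw [if_pos hi, cpw_sum (inv_ne_zero (inv_mul_norm_pos (hdeg i hi)).ne')]
      refine Finset.prod_congr rfl fun q hq => ?_
      rw [(Finset.mem_filter.1 hq).2, if_pos hi]
    · rw [if_neg hi, Finset.prod_eq_one]
      intro q hq
      rw [(Finset.mem_filter.1 hq).2, if_neg hi]
  rw [hswap fun q => q.1.1, hswap fun q => q.1.2]
  have hD : ∀ i, (p : ℂ)⁻¹ * (if Marked (f i) then
      cpw ((p : ℝ)⁻¹ * ‖y i‖) (markWeight (f i) s i) else 1) = _ := fun i =>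
    (density_mul_factor s i (f i) (y i) (hdeg i)).symm
  simp only [hD]
  have hsplit : ∀ i, (if f i = none then cpw ((p : ℝ)⁻¹ * ‖y i‖)⁻¹
      ((∑ q : Pairs N with q.1.1 = i, cPair s q) + ∑ q : Pairs N with q.1.2 = i, cPair s q) else 1) =
      (if f i = none then cpw ((p : ℝ)⁻¹ * ‖y i‖)⁻¹ (∑ q : Pairs N with q.1.1 = i, cPair s q)
        else 1) * (if f i = none then cpw ((p : ℝ)⁻¹ * ‖y i‖)⁻¹
        (∑ q : Pairs N with q.1.2 = i, cPair s q) else 1) := by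
    intro i
    split_ifs
    · exact cpw_add _ _ _
    · rw [mul_one]
  simp only [hsplit, Finset.prod_mul_distrib]
  push_cast
  ring

end Charts

/-! ### The affine forms and the common denominator -/

section Forms

set_option linter.unusedSectionVars false

variable {p : ℕ} [hp : Fact p.Prime] {N : ℕ}

/-- The affine form `d + ∑_{k ∈ A} s_k`. -/
def affForm (d : ℕ) (A : Finset (Idx N)) (s : Idx N → ℂ) : ℂ := d + ∑ k ∈ A, s k

/-- The pairs of elements of `J`. -/
def pairsWithin (J : Finset (T N)) : Finset (Pairs N) :=
  Finset.univ.filter fun q => q.1.1 ∈ J ∧ q.1.2 ∈ J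

/-- The pairs with at least one element in `J`. -/
def pairsTouching (J : Finset (T N)) : Finset (Pairs N) :=
  Finset.univ.filter fun q => q.1.1 ∈ J ∨ q.1.2 ∈ J

/-- The set of indices consisting of the `1i`, `(N-1)j` and `q` with `i ∈ A`, `j ∈ B`, `q ∈ C`. -/
def idxSet (A B : Finset (T N)) (C : Finset (Pairs N)) : Finset (Idx N) :=
  A.disjSum (B.disjSum C)

theorem sum_idxSet {R : Type} [AddCommMonoid R] (A B : Finset (T N)) (C : Finset (Pairs N))
    (s : Idx N → R) :
    ∑ k ∈ idxSet A B C, s k = ∑ i ∈ A, c1 s i + (∑ i ∈ B, cLast s i + ∑ q ∈ C, cPair s q) := by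
  simp only [idxSet, Finset.sum_disjSum]
  rfl

theorem affForm_re (d : ℕ) (A : Finset (Idx N)) (s : Idx N → ℂ) :
    (affForm d A s).re = d + ∑ k ∈ A, rePart s k := by
  simp [affForm, rePart]

theorem affForm_diag_re {K : Finset (T N)} (hK : 1 ≤ K.card) (s : Idx N → ℂ) :
    (affForm (K.card - 1) (idxSet ∅ ∅ (pairsWithin K)) s).re = formDiag K (rePart s) := by
  rw [affForm_re, sum_idxSet, formDiag, Nat.cast_sub hK]
  simp [pairsWithin]

theorem affForm_zero_re (J : Finset (T N)) (s : Idx N → ℂ) :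
    (affForm J.card (idxSet J ∅ (pairsWithin J)) s).re = formZero J (rePart s) := by
  rw [affForm_re, sum_idxSet, formZero]
  simp [pairsWithin, add_assoc]

theorem affForm_one_re (J : Finset (T N)) (s : Idx N → ℂ) :
    (affForm J.card (idxSet ∅ J (pairsWithin J)) s).re = formOne J (rePart s) := by
  rw [affForm_re, sum_idxSet, formOne]
  simp [pairsWithin, add_assoc]

theorem affForm_infty_re (J : Finset (T N)) (s : Idx N → ℂ) :
    (affForm J.card (idxSet J J (pairsTouching J)) s).re = formInfty J (rePart s) := by
  have h : ∑ q ∈ pairsTouching J, cPair (rePart s) q =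
      (∑ q : Pairs N with q.1.1 ∈ J, cPair (rePart s) q) +
        ∑ q : Pairs N with q.1.1 ∉ J ∧ q.1.2 ∈ J, cPair (rePart s) q := by
    rw [← Finset.sum_union]
    · refine Finset.sum_congr ?_ fun _ _ => rfl
      ext q
      simp only [pairsTouching, Finset.mem_filter, Finset.mem_union, Finset.mem_univ, true_and]
      tauto
    · rw [Finset.disjoint_filter]
      tauto
  rw [affForm_re, sum_idxSet, formInfty, h, Finset.sum_add_distrib]
  ring

theorem card_sub_one_of_bot_mem {I : Finset (WithBot (T N))} (hb : ⊥ ∈ I) :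
    (I.card : ℂ) - 1 = (ordinary I).card := by
  rw [card_ordinary, if_pos hb]; push_cast; ring

theorem sum_pairsWithin (a : Option (ZMod p)) (I : Finset (WithBot (T N))) (s : Idx N → ℂ) :
    ∑ q : Pairs N with q.1.1 ∈ ordinary I ∧ q.1.2 ∈ ordinary I,
      classWeight a s ((q.1.1 : WithBot (T N)), (q.1.2 : WithBot (T N))) =
      ∑ q ∈ pairsWithin (ordinary I), cPair s q :=
  Finset.sum_congr rfl fun q _ => classWeight_pair a s q

theorem weightSum_of_bot_notMem (a : Option (ZMod p)) {I : Finset (WithBot (T N))} (hb : ⊥ ∉ I)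
    (s : Idx N → ℂ) :
    weightSum (classWeight a s) I = ∑ q ∈ pairsWithin (ordinary I), cPair s q := by
  rw [weightSum, sum_pairsIn, if_neg hb, zero_add, sum_pairsWithin]

theorem weightSum_of_bot_mem (a : Option (ZMod p)) {I : Finset (WithBot (T N))} (hb : ⊥ ∈ I)
    (s : Idx N → ℂ) :
    weightSum (classWeight a s) I = ∑ i ∈ ordinary I, markWeight a s i +
      ∑ q ∈ pairsWithin (ordinary I), cPair s q := by
  rw [weightSum, sum_pairsIn, if_pos hb, sum_pairsWithin]
  rfl

theorem exponent_diag (a : Option (ZMod p)) {I : Finset (WithBot (T N))} (hb : ⊥ ∉ I)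
    (hI : 1 ≤ I.card) (s : Idx N → ℂ) :
    (I.card : ℂ) - 1 + weightSum (classWeight a s) I =
      affForm ((ordinary I).card - 1) (idxSet ∅ ∅ (pairsWithin (ordinary I))) s := by
  have hc := card_ordinary I
  rw [if_neg hb, zero_add] at hc
  rw [weightSum_of_bot_notMem a hb, affForm, sum_idxSet, hc, Nat.cast_sub (hc ▸ hI)]
  simp

theorem exponent_zero {I : Finset (WithBot (T N))} (hb : ⊥ ∈ I) (s : Idx N → ℂ) :
    (I.card : ℂ) - 1 + weightSum (classWeight (some (0 : ZMod p)) s) I =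
      affForm (ordinary I).card (idxSet (ordinary I) ∅ (pairsWithin (ordinary I))) s := by
  rw [weightSum_of_bot_mem _ hb, card_sub_one_of_bot_mem hb, affForm, sum_idxSet]
  simp [markWeight]

theorem exponent_one {a : ZMod p} (ha : a ≠ 0) {I : Finset (WithBot (T N))} (hb : ⊥ ∈ I)
    (s : Idx N → ℂ) :
    (I.card : ℂ) - 1 + weightSum (classWeight (some a) s) I =
      affForm (ordinary I).card (idxSet ∅ (ordinary I) (pairsWithin (ordinary I))) s := by
  rw [weightSum_of_bot_mem _ hb, card_sub_one_of_bot_mem hb, affForm, sum_idxSet]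
  simp [markWeight, ha]

/-- The weights at `⊥` count pairs inside `J` twice and pairs with one end in `J` once, all
negatively. Adding the pairs inside `J` once leaves minus the pairs that touch `J`, and `|J| - 2|J|
= -|J|` accounts for the constant. -/
theorem exponent_infty {I : Finset (WithBot (T N))} (hb : ⊥ ∈ I) (s : Idx N → ℂ) :
    (I.card : ℂ) - 1 + weightSum (classWeight (none : Option (ZMod p)) s) I =
      -affForm (ordinary I).card
        (idxSet (ordinary I) (ordinary I) (pairsTouching (ordinary I))) s := by
  rw [weightSum_of_bot_mem _ hb, card_sub_one_of_bot_mem hb, affForm, sum_idxSet]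
  set J := ordinary I
  have hfib : ∀ π : Pairs N → T N, ∑ i ∈ J, ∑ q : Pairs N with π q = i, cPair s q =
      ∑ q : Pairs N with π q ∈ J, cPair s q := fun π =>
    Finset.sum_fiberwise_eq_sum_filter Finset.univ J π (cPair s)
  have hor : ∑ q ∈ pairsTouching J, cPair s q + ∑ q ∈ pairsWithin J, cPair s q =
      (∑ q : Pairs N with q.1.1 ∈ J, cPair s q) + ∑ q : Pairs N with q.1.2 ∈ J, cPair s q := by
    rw [pairsTouching, pairsWithin, Finset.filter_or, Finset.filter_and, Finset.sum_union_inter]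
  simp only [markWeight, Finset.sum_neg_distrib, Finset.sum_add_distrib, hfib, Finset.sum_const,
    nsmul_eq_mul]
  linear_combination hor

variable (p) in
/-- The polynomial with value `1 - p ^ (-(d + ∑_{k ∈ A} s_k))`. -/
def affFactor (d : ℕ) (A : Finset (Idx N)) : MvPolynomial (Idx N) ℂ :=
  1 - MvPolynomial.C ((p : ℂ)⁻¹ ^ d) * ∏ k ∈ A, MvPolynomial.X k

theorem cpow_neg_affForm (d : ℕ) (A : Finset (Idx N)) (s : Idx N → ℂ) :
    (p : ℂ) ^ (-affForm d A s) = (p : ℂ)⁻¹ ^ d * ∏ k ∈ A, (p : ℂ) ^ (-s k) := by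
  have hp0 : (p : ℂ) ≠ 0 := by exact_mod_cast hp.out.ne_zero
  rw [affForm, neg_add, Complex.cpow_add _ _ hp0, Complex.cpow_neg, Complex.cpow_natCast, inv_pow,
    ← Finset.sum_neg_distrib]
  congr 1
  induction A using Finset.induction_on with
  | empty => simp
  | insert k A hk ih =>
    rw [Finset.sum_insert hk, Finset.prod_insert hk, Complex.cpow_add _ _ hp0, ih]

theorem evalAt_affFactor (d : ℕ) (A : Finset (Idx N)) (s : Idx N → ℂ) :
    evalAt p (affFactor p d A) s = 1 - (p : ℂ) ^ (-affForm d A s) := by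
  rw [cpow_neg_affForm]
  simp [evalAt, affFactor]

/-- The norm of `p ^ (-z)` depends only on `Re z` and equals `1` only for `Re z = 0`. This is what
places the poles on real hyperplanes. -/
theorem evalAt_affFactor_ne_zero {d : ℕ} {A : Finset (Idx N)} {s : Idx N → ℂ}
    (h : (affForm d A s).re ≠ 0) : evalAt p (affFactor p d A) s ≠ 0 := by
  rw [evalAt_affFactor]
  intro h0
  have h1 := congrArg norm (sub_eq_zero.1 h0)
  have hp1 : (1 : ℝ) < p := by exact_mod_cast hp.out.one_lt
  rw [norm_one, Complex.norm_natCast_cpow_of_pos hp.out.pos, Complex.neg_re] at h1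
  rcases h.lt_or_gt with hlt | hgt
  · exact (Real.one_lt_rpow hp1 (neg_pos.2 hlt)).ne h1
  · exact (Real.rpow_lt_one_of_one_lt_of_neg hp1 (neg_lt_zero.2 hgt)).ne' h1

variable (p N) in
/-- A common denominator of the cluster integrals. -/
def commonDenom : MvPolynomial (Idx N) ℂ :=
  (∏ k, MvPolynomial.X k) *
    ((∏ K : Finset (T N) with 2 ≤ K.card, affFactor p (K.card - 1) (idxSet ∅ ∅ (pairsWithin K))) *
      ∏ J : Finset (T N) with J.Nonempty, affFactor p J.card (idxSet J ∅ (pairsWithin J)) *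
        (affFactor p J.card (idxSet ∅ J (pairsWithin J)) *
          affFactor p J.card (idxSet J J (pairsTouching J))))

/-- The disc at infinity produces powers `p ^ s_k`, which are inverses of the variables; so the
variables must divide the denominator as well. -/
theorem X_dvd_commonDenom (k : Idx N) : MvPolynomial.X k ∣ commonDenom p N :=
  (Finset.dvd_prod_of_mem _ (Finset.mem_univ k)).mul_right _

theorem diag_dvd_commonDenom {K : Finset (T N)} (hK : 2 ≤ K.card) :
    affFactor p (K.card - 1) (idxSet ∅ ∅ (pairsWithin K)) ∣ commonDenom p N :=
  ((Finset.dvd_prod_of_mem (fun K : Finset (T N) =>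
    affFactor p (K.card - 1) (idxSet ∅ ∅ (pairsWithin K)))
    (Finset.mem_filter.2 ⟨Finset.mem_univ K, hK⟩)).mul_right _).mul_left _

theorem nonempty_dvd_commonDenom {J : Finset (T N)} (hJ : J.Nonempty) :
    affFactor p J.card (idxSet J ∅ (pairsWithin J)) *
        (affFactor p J.card (idxSet ∅ J (pairsWithin J)) *
          affFactor p J.card (idxSet J J (pairsTouching J))) ∣ commonDenom p N :=
  ((Finset.dvd_prod_of_mem (fun J : Finset (T N) =>
    affFactor p J.card (idxSet J ∅ (pairsWithin J)) *
        (affFactor p J.card (idxSet ∅ J (pairsWithin J)) *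
          affFactor p J.card (idxSet J J (pairsTouching J))))
    (Finset.mem_filter.2 ⟨Finset.mem_univ J, hJ⟩)).mul_left _).mul_left _

theorem evalAt_commonDenom_ne_zero {s : Idx N → ℂ} (hs : rePart s ∉ polarHyperplanes N) :
    evalAt p (commonDenom p N) s ≠ 0 := by
  have hp0 : (p : ℂ) ≠ 0 := by exact_mod_cast hp.out.ne_zero
  simp only [polarHyperplanes, Set.mem_ofPred_eq, not_or, not_exists, not_and] at hs
  obtain ⟨h1, h2, h3, h4⟩ := hs
  have hmul : ∀ A B : MvPolynomial (Idx N) ℂ, evalAt p (A * B) s = evalAt p A s * evalAt p B s :=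
    fun A B => map_mul _ A B
  have hprod : ∀ {κ : Type} (S : Finset κ) (F : κ → MvPolynomial (Idx N) ℂ),
      evalAt p (∏ k ∈ S, F k) s = ∏ k ∈ S, evalAt p (F k) s := fun S F => map_prod _ F S
  rw [commonDenom, hmul, hmul, hprod, hprod, hprod]
  refine mul_ne_zero (Finset.prod_ne_zero_iff.2 fun k _ => ?_) (mul_ne_zero
    (Finset.prod_ne_zero_iff.2 fun K hK => ?_) (Finset.prod_ne_zero_iff.2 fun J hJ => ?_))
  · simp [evalAt, Complex.cpow_eq_zero_iff, hp0]
  · have hK := (Finset.mem_filter.1 hK).2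
    exact evalAt_affFactor_ne_zero (by rw [affForm_diag_re (by omega)]; exact h2 K hK)
  · have hJ := (Finset.mem_filter.1 hJ).2
    rw [hmul, hmul]
    exact mul_ne_zero (evalAt_affFactor_ne_zero (by rw [affForm_zero_re]; exact h3 J hJ))
      (mul_ne_zero (evalAt_affFactor_ne_zero (by rw [affForm_one_re]; exact h4 J hJ))
        (evalAt_affFactor_ne_zero (by rw [affForm_infty_re]; exact h1 J hJ)))

theorem notMem_polarHyperplanes {s : Idx N → ℂ} (hs : s ∈ regionH N) :
    rePart s ∉ polarHyperplanes N := by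
  obtain ⟨h1, h2, h3, h4⟩ := hs
  rintro (⟨J, hJ, h⟩ | ⟨K, hK, h⟩ | ⟨J, hJ, h⟩ | ⟨J, hJ, h⟩)
  · exact (h1 J hJ).ne h
  · exact (h2 K hK).ne' h
  · exact (h3 J hJ).ne' h
  · exact (h4 J hJ).ne' h

theorem ordinary_nonempty {I : Finset (WithBot (T N))} (hI : 2 ≤ I.card) : (ordinary I).Nonempty := by
  have h := card_ordinary I
  refine Finset.card_pos.1 ?_
  split_ifs at h <;> omega

/-- Sets without `⊥` give the diagonal forms, and sets with `⊥` those of `0`, `1` or, negated, `∞`.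
All classes `a` can be admitted, because `markWeight` treats every non-zero digit like `1`. -/
theorem exponent_pos {s : Idx N → ℂ} (hs : s ∈ regionH N) (a : Option (ZMod p))
    (I : Finset (WithBot (T N))) (hI : 2 ≤ I.card) :
    0 < (I.card : ℝ) - 1 + (weightSum (classWeight a s) I).re := by
  obtain ⟨h1, h2, h3, h4⟩ := hs
  have hre : (I.card : ℝ) - 1 + (weightSum (classWeight a s) I).re =
      ((I.card : ℂ) - 1 + weightSum (classWeight a s) I).re := by simp
  have hJ := ordinary_nonempty hI
  rw [hre]
  by_cases hb : ⊥ ∈ I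
  · cases a with
    | none =>
      rw [exponent_infty hb, Complex.neg_re, affForm_infty_re]
      exact neg_pos.2 (h1 _ hJ)
    | some a =>
      by_cases ha : a = 0
      · subst ha
        rw [exponent_zero hb, affForm_zero_re]
        exact h3 _ hJ
      · rw [exponent_one ha hb, affForm_one_re]
        exact h4 _ hJ
  · have hc := card_ordinary I
    rw [if_neg hb, zero_add] at hc
    rw [exponent_diag a hb (by omega), affForm_diag_re (by omega)]
    exact h2 _ (by omega)

/-! ### Rational functions on the region of convergence -/

variable (p N) in
/-- The functions on `regionH` of the form `P(p^{-s}) / D(p^{-s}) ^ n`, where `D` is the common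
denominator. -/
def rationalFunctions : Subring (regionH N → ℂ) where
  carrier := {g | ∃ (P : MvPolynomial (Idx N) ℂ) (n : ℕ), ∀ s : regionH N,
    g s = evalAt p P s / evalAt p (commonDenom p N) s ^ n}
  mul_mem' := by
    rintro g h ⟨P, n, hg⟩ ⟨P', n', hh⟩
    refine ⟨P * P', n + n', fun s => ?_⟩
    have hm : evalAt p (P * P') s = evalAt p P s * evalAt p P' s := map_mul _ P P'
    rw [Pi.mul_apply, hg, hh, hm, pow_add, div_mul_div_comm]
  one_mem' := ⟨1, 0, fun s => by simp [evalAt]⟩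
  add_mem' := by
    rintro g h ⟨P, n, hg⟩ ⟨P', n', hh⟩
    refine ⟨P * commonDenom p N ^ n' + commonDenom p N ^ n * P', n + n', fun s => ?_⟩
    have h0 := evalAt_commonDenom_ne_zero (p := p) (notMem_polarHyperplanes s.2)
    have hm : evalAt p (P * commonDenom p N ^ n' + commonDenom p N ^ n * P') s =
        evalAt p P s * evalAt p (commonDenom p N) s ^ n' +
          evalAt p (commonDenom p N) s ^ n * evalAt p P' s := by
      simp [evalAt]
    rw [Pi.add_apply, hg, hh, hm, pow_add, div_add_div _ _ (pow_ne_zero _ h0) (pow_ne_zero _ h0)]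
  zero_mem' := ⟨0, 0, fun s => by simp [evalAt]⟩
  neg_mem' := by
    rintro g ⟨P, n, hg⟩
    refine ⟨-P, n, fun s => ?_⟩
    have hm : evalAt p (-P) s = -evalAt p P s := map_neg _ P
    rw [Pi.neg_apply, hg, hm, neg_div]

theorem evalAt_mem (P : MvPolynomial (Idx N) ℂ) :
    (fun s : regionH N => evalAt p P s) ∈ rationalFunctions p N :=
  ⟨P, 0, fun s => by simp⟩

theorem const_mem (c : ℂ) : (fun _ : regionH N => c) ∈ rationalFunctions p N := by
  have h := evalAt_mem (p := p) (N := N) (MvPolynomial.C c)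
  simpa [evalAt] using h

theorem inv_evalAt_mem {P : MvPolynomial (Idx N) ℂ} (h : P ∣ commonDenom p N) :
    (fun s : regionH N => (evalAt p P s)⁻¹) ∈ rationalFunctions p N := by
  obtain ⟨P', hP'⟩ := h
  refine ⟨P', 1, fun s => ?_⟩
  have h0 := evalAt_commonDenom_ne_zero (p := p) (notMem_polarHyperplanes s.2)
  have hm : evalAt p (commonDenom p N) s = evalAt p P s * evalAt p P' s := by
    rw [hP']; exact map_mul _ P P'
  rw [hm] at h0
  rw [hm, pow_one, mul_comm, div_mul_cancel_left₀ (right_ne_zero_of_mul h0)]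

theorem cpow_neg_affForm_mem (d : ℕ) (A : Finset (Idx N)) :
    (fun s : regionH N => (p : ℂ) ^ (-affForm d A s)) ∈ rationalFunctions p N := by
  have h := (rationalFunctions p N).sub_mem (const_mem 1) (evalAt_mem (affFactor p d A))
  convert h using 1
  funext s
  rw [Pi.sub_apply, evalAt_affFactor]
  ring

theorem cpow_affForm_mem (d : ℕ) (A : Finset (Idx N)) :
    (fun s : regionH N => (p : ℂ) ^ affForm d A s) ∈ rationalFunctions p N := by
  have h := (rationalFunctions p N).mul_mem (const_mem ((p : ℂ) ^ d))
    ((rationalFunctions p N).prod_mem fun k (_ : k ∈ A) =>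
      inv_evalAt_mem (X_dvd_commonDenom (p := p) k))
  convert h using 1
  funext s
  have h2 := cpow_neg_affForm (p := p) d A s
  rw [Complex.cpow_neg] at h2
  rw [← inv_inv ((p : ℂ) ^ affForm d A s), h2, mul_inv, inv_pow, inv_inv, ← Finset.prod_inv_distrib,
    Pi.mul_apply, Finset.prod_apply]
  simp [evalAt]

theorem inv_one_sub_cpow_mem {d : ℕ} {A : Finset (Idx N)} (h : affFactor p d A ∣ commonDenom p N) :
    (fun s : regionH N => (1 - (p : ℂ) ^ (-affForm d A s))⁻¹) ∈ rationalFunctions p N := by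
  simpa only [evalAt_affFactor] using inv_evalAt_mem h

/-- The negated forms at infinity need no new denominators, since `1 / (1 - z) = -z⁻¹ / (1 - z⁻¹)`.
-/
theorem inv_one_sub_cpow_mem' {d : ℕ} {A : Finset (Idx N)} (h : affFactor p d A ∣ commonDenom p N) :
    (fun s : regionH N => (1 - (p : ℂ) ^ affForm d A s)⁻¹) ∈ rationalFunctions p N := by
  have h := (rationalFunctions p N).neg_mem ((rationalFunctions p N).mul_mem
    (cpow_neg_affForm_mem d A) (inv_one_sub_cpow_mem h))
  convert h using 1
  funext s
  have hp0 : (p : ℂ) ≠ 0 := by exact_mod_cast hp.out.ne_zero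
  have hz : (p : ℂ) ^ affForm d A s ≠ 0 := by simp [Complex.cpow_eq_zero_iff, hp0]
  rw [Pi.neg_apply, Pi.mul_apply, Complex.cpow_neg, ← mul_inv, ← inv_neg]
  congr 1
  field_simp
  ring

theorem ratio_cases (a : Option (ZMod p)) {I : Finset (WithBot (T N))} (hI : 2 ≤ I.card) :
    ∃ (d : ℕ) (A : Finset (Idx N)), affFactor p d A ∣ commonDenom p N ∧
      ((∀ s, (I.card : ℂ) - 1 + weightSum (classWeight a s) I = affForm d A s) ∨
        ∀ s, (I.card : ℂ) - 1 + weightSum (classWeight a s) I = -affForm d A s) := by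
  have hdvd := nonempty_dvd_commonDenom (p := p) (ordinary_nonempty hI)
  by_cases hb : ⊥ ∈ I
  · cases a with
    | none =>
      exact ⟨_, _, (Dvd.intro_left _ (mul_assoc _ _ _)).trans hdvd, Or.inr (exponent_infty hb)⟩
    | some a =>
      by_cases ha : a = 0
      · subst ha
        exact ⟨_, _, (Dvd.intro _ rfl).trans hdvd, Or.inl (exponent_zero hb)⟩
      · exact ⟨_, _, ((Dvd.intro _ rfl).mul_left _).trans hdvd, Or.inl (exponent_one ha hb)⟩
  · have hc := card_ordinary I
    rw [if_neg hb, zero_add] at hc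
    exact ⟨_, _, diag_dvd_commonDenom (by omega), Or.inl (exponent_diag a hb (by omega))⟩

theorem cpow_weightSum_mem (a : Option (ZMod p)) (I : Finset (WithBot (T N))) :
    (fun s : regionH N => (p : ℂ) ^ (-weightSum (classWeight a s) I)) ∈ rationalFunctions p N := by
  have hp0 : (p : ℂ) ≠ 0 := by exact_mod_cast hp.out.ne_zero
  rcases Nat.lt_or_ge I.card 2 with hI | hI
  · have : (fun s : regionH N => (p : ℂ) ^ (-weightSum (classWeight a s) I)) = fun _ => 1 := by
      funext s; rw [weightSum_of_card_le_one _ (by omega)]; simp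
    rw [this]
    exact const_mem 1
  obtain ⟨d, A, _, h | h⟩ := ratio_cases a hI
  · have h2 := (rationalFunctions p N).mul_mem (const_mem ((p : ℂ) ^ ((I.card : ℂ) - 1)))
      (cpow_neg_affForm_mem d A)
    convert h2 using 1
    funext s
    rw [Pi.mul_apply, ← Complex.cpow_add _ _ hp0, ← h]
    congr 1
    ring
  · have h2 := (rationalFunctions p N).mul_mem (const_mem ((p : ℂ) ^ ((I.card : ℂ) - 1)))
      (cpow_affForm_mem d A)
    convert h2 using 1
    funext s
    rw [Pi.mul_apply, ← Complex.cpow_add _ _ hp0, ← neg_neg (affForm d A s), ← h]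
    congr 1
    ring

theorem inv_one_sub_ratio_mem (a : Option (ZMod p)) (I : Finset (WithBot (T N)))
    (hI : 2 ≤ I.card) :
    (fun s : regionH N => (1 - ratio p (classWeight a s) I)⁻¹) ∈ rationalFunctions p N := by
  obtain ⟨d, A, hd, h | h⟩ := ratio_cases a hI
  · simpa only [ratio, h] using inv_one_sub_cpow_mem hd
  · simpa only [ratio, h, neg_neg] using inv_one_sub_cpow_mem' hd

theorem clusterIntegral_classWeight_mem (a : Option (ZMod p)) (I : Finset (WithBot (T N))) :
    (fun s : regionH N => clusterIntegral p (classWeight a s) I) ∈ rationalFunctions p N :=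
  clusterIntegral_mem _ (fun s => exponent_pos s.2 a) (const_mem _) (cpow_weightSum_mem a)
    (inv_one_sub_ratio_mem a) I

/-! ### Convergence and rationality of the integral -/

theorem integrable_and_integral_integrandZero {s : Idx N → ℂ} (hs : s ∈ regionH N) :
    Integrable (integrandZero s) (haarN p N) ∧
      ∫ x, integrandZero s x ∂haarN p N = ∑ f : T N → Option (ZMod p), ∏ a,
        (p : ℂ)⁻¹ ^ (ordinary (classSet f a)).card *
          (p : ℂ) ^ (-weightSum (classWeight a s) (classSet f a)) *
          clusterIntegral p (classWeight a s) (classSet f a) := by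
  have hm : ∀ (f : T N → Option (ZMod p)) (a : Option (ZMod p)),
      Measurable fun y : T N → ℤ_[p] => (p : ℂ)⁻¹ ^ (ordinary (classSet f a)).card *
        (p : ℂ) ^ (-weightSum (classWeight a s) (classSet f a)) *
        cluster (classWeight a s) (classSet f a) y := fun f a =>
    (measurable_cluster _ _).const_mul _
  have hdep : ∀ (f : T N → Option (ZMod p)) (a : Option (ZMod p)),
      DependsOn (fun y : T N → ℤ_[p] => (p : ℂ)⁻¹ ^ (ordinary (classSet f a)).card *
        (p : ℂ) ^ (-weightSum (classWeight a s) (classSet f a)) *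
        cluster (classWeight a s) (classSet f a) y) (ordinary (classSet f a) : Set (T N)) := by
    intro f a y y' h
    simp only [dependsOn_cluster _ _ h]
  have h := integrable_integral_pi_chart (ι := T N) measurable_projChart measurable_projDensity
    (haarQp_eq_sum (p := p)) (measurable_integrandZero (p := p) s) (fun f => by
      simp only [integrandZero_projChart]
      exact integrable_prod_of_dependsOn (μ := haarZp p) Finset.univ
        (disjoint_ordinary_classSet f) (hm f) (hdep f)
        fun a _ => (integrable_cluster (exponent_pos hs a) _).const_mul _)
  refine ⟨h.1, h.2.trans (Finset.sum_congr rfl fun f _ => ?_)⟩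
  simp only [integrandZero_projChart]
  rw [integral_prod_of_dependsOn (μ := haarZp p) Finset.univ
    (disjoint_ordinary_classSet f) (hm f) (hdep f)]
  simp only [integral_const_mul, clusterIntegral]

theorem integrableOn_integrand {s : Idx N → ℂ} (hs : s ∈ regionH N) :
    IntegrableOn (integrand p s) (Lam p N)ᶜ (haarN p N) := by
  rw [← integrable_indicator_iff measurableSet_Lam.compl, indicator_integrand]
  exact (integrable_and_integral_integrandZero hs).1

theorem zeta_mem : (fun s : regionH N => zeta p N s) ∈ rationalFunctions p N := by
  have h : (fun s : regionH N => zeta p N s) = ∑ f : T N → Option (ZMod p), ∏ a,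
      (fun _ => (p : ℂ)⁻¹ ^ (ordinary (classSet f a)).card) *
        (fun s : regionH N => (p : ℂ) ^ (-weightSum (classWeight a s) (classSet f a))) *
        (fun s : regionH N => clusterIntegral p (classWeight a s) (classSet f a)) := by
    funext s
    rw [zeta, ← integral_indicator measurableSet_Lam.compl, indicator_integrand,
      (integrable_and_integral_integrandZero s.2).2]
    simp only [Finset.sum_apply, Finset.prod_apply, Pi.mul_apply]
  rw [h]
  exact (rationalFunctions p N).sum_mem fun f _ => (rationalFunctions p N).prod_mem fun a _ =>
    (rationalFunctions p N).mul_mem ((rationalFunctions p N).mul_mem (const_mem _)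
      (cpow_weightSum_mem a _)) (clusterIntegral_classWeight_mem a _)

end Forms

/-! ### Openness, analyticity, and the tube -/

section Region

variable {N : ℕ}

theorem continuous_rePart : Continuous (rePart : (Idx N → ℂ) → Idx N → ℝ) :=
  continuous_pi fun k => Complex.continuous_re.comp (continuous_apply k)

theorem isOpen_regionH : IsOpen (regionH N) := by
  have hre : ∀ k : Idx N, Continuous fun s : Idx N → ℂ => rePart s k := fun k =>
    (continuous_apply k).comp continuous_rePart
  have h : regionH N =
      (⋂ J : Finset (T N), ⋂ _ : J.Nonempty, {s | formInfty J (rePart s) < 0}) ∩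
      ((⋂ K : Finset (T N), ⋂ _ : 2 ≤ K.card, {s | 0 < formDiag K (rePart s)}) ∩
      ((⋂ J : Finset (T N), ⋂ _ : J.Nonempty, {s | 0 < formZero J (rePart s)}) ∩
      (⋂ J : Finset (T N), ⋂ _ : J.Nonempty, {s | 0 < formOne J (rePart s)}))) := by
    ext s
    simp [regionH]
  rw [h]
  refine IsOpen.inter ?_ (IsOpen.inter ?_ (IsOpen.inter ?_ ?_)) <;>
    refine isOpen_iInter_of_finite fun J => isOpen_iInter_of_finite fun _ => ?_
  · refine isOpen_lt ?_ continuous_const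
    unfold formInfty c1 cLast cPair
    fun_prop
  · refine isOpen_lt continuous_const ?_
    unfold formDiag cPair
    fun_prop
  · refine isOpen_lt continuous_const ?_
    unfold formZero c1 cPair
    fun_prop
  · refine isOpen_lt continuous_const ?_
    unfold formOne cLast cPair
    fun_prop

theorem analyticAt_evalAt (p : ℕ) [hp : Fact p.Prime] (P : MvPolynomial (Idx N) ℂ)
    (s : Idx N → ℂ) : AnalyticAt ℂ (evalAt p P) s := by
  have hp0 : (p : ℂ) ≠ 0 := by exact_mod_cast hp.out.ne_zero
  have h := AnalyticAt.aeval_mvPolynomial (𝕜 := ℂ) (z := s)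
    (f := fun (s : Idx N → ℂ) k => (p : ℂ) ^ (-(s k))) (fun k => by
      have hk : AnalyticAt ℂ (fun s : Idx N → ℂ => s k) s :=
        (ContinuousLinearMap.proj (R := ℂ) (φ := fun _ : Idx N => ℂ) k).analyticAt s
      simp only [Complex.cpow_def_of_ne_zero hp0]
      exact (analyticAt_const.mul hk.neg).cexp) P
  exact h

/-- The lower bounds of the real parts in the tube. -/
def tubeLower (N : ℕ) : Idx N → ℝ :=
  Sum.elim (fun _ => -2 / 3) (Sum.elim (fun _ => -2 / 3)
    fun _ => -2 / (3 * (((N : ℝ) - 4) * ((N : ℝ) - 3) / 2)))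

/-- The upper bounds of the real parts in the tube. -/
def tubeUpper (N : ℕ) : Idx N → ℝ :=
  Sum.elim (fun _ => -1 / 2) (Sum.elim (fun _ => -1 / 2) fun _ => 0)

theorem tube_eq_pi :
    tube N = Set.univ.pi fun k => Complex.re ⁻¹' Set.Ioo (tubeLower N k) (tubeUpper N k) := by
  ext s
  simp only [tube, Set.mem_ofPred_eq, Set.mem_pi, Set.mem_univ, true_imp_iff, Set.mem_preimage,
    Set.mem_Ioo, Sum.forall, tubeLower, tubeUpper, Sum.elim_inl, Sum.elim_inr, c1, cLast, cPair]
  tauto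

/-- Swapping matches the pairs `i < j` with the pairs `j < i`, and together they form the
off-diagonal. -/
theorem two_mul_card_pairs : 2 * Fintype.card (Pairs N) = (N - 3) * (N - 3 - 1) := by
  have hT : Fintype.card (T N) = N - 3 := by
    rw [Fintype.card_coe, Nat.card_Icc]; omega
  have h1 : Fintype.card (Pairs N) =
      ((Finset.univ : Finset (T N × T N)).filter fun q => q.1 < q.2).card :=
    Fintype.card_subtype _
  have h2 : ((Finset.univ : Finset (T N × T N)).filter fun q => q.1 < q.2).card =
      ((Finset.univ : Finset (T N × T N)).filter fun q => q.2 < q.1).card :=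
    Finset.card_bij (fun q _ => q.swap) (by simp) (by simp)
      (fun q hq => ⟨q.swap, by simpa using hq, by simp⟩)
  have h3 : (Finset.univ : Finset (T N)).offDiag =
      ((Finset.univ : Finset (T N × T N)).filter fun q => q.1 < q.2) ∪
      ((Finset.univ : Finset (T N × T N)).filter fun q => q.2 < q.1) := by
    ext q
    simp only [Finset.mem_offDiag, Finset.mem_univ, true_and, Finset.mem_union, Finset.mem_filter]
    exact lt_or_lt_iff_ne.symm
  have h4 := congrArg Finset.card h3
  rw [Finset.card_union_of_disjoint, ← h2, ← h1, Finset.offDiag_card, Finset.card_univ, hT] at h4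
  · rw [two_mul, ← h4, Nat.mul_sub_one]
  · rw [Finset.disjoint_filter]
    exact fun q _ h h' => lt_asymm h h'

theorem card_pairs (hN : 4 ≤ N) :
    (Fintype.card (Pairs N) : ℝ) = ((N : ℝ) - 4) * ((N : ℝ) - 3) / 2 := by
  have h := two_mul_card_pairs (N := N)
  obtain ⟨m, rfl⟩ := Nat.exists_eq_add_of_le hN
  have e1 : 4 + m - 3 = m + 1 := by omega
  rw [e1, Nat.add_sub_cancel] at h
  have h' : 2 * (Fintype.card (Pairs (4 + m)) : ℝ) = (m + 1) * m := by exact_mod_cast h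
  push_cast
  linarith

theorem isOpen_tube : IsOpen (tube N) := by
  rw [tube_eq_pi]
  exact isOpen_set_pi Set.finite_univ fun k _ => isOpen_Ioo.preimage Complex.continuous_re

theorem isConnected_tube (hN : 4 ≤ N) : IsConnected (tube N) := by
  constructor
  · rw [tube_eq_pi, Set.univ_pi_nonempty_iff]
    intro k
    suffices h : tubeLower N k < tubeUpper N k by
      refine ⟨(((tubeLower N k + tubeUpper N k) / 2 : ℝ) : ℂ), ?_⟩
      simp only [Set.mem_preimage, Complex.ofReal_re, Set.mem_Ioo]
      constructor <;> linarith
    rcases k with i | i | q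
    · norm_num [tubeLower, tubeUpper]
    · norm_num [tubeLower, tubeUpper]
    · simp only [tubeLower, tubeUpper, Sum.elim_inr]
      rw [← card_pairs hN]
      -- The index `q` itself shows that there are pairs; for `N = 4` the bound would be a division
      -- by zero, but no such index exists.
      have : 0 < (Fintype.card (Pairs N) : ℝ) := by exact_mod_cast Fintype.card_pos_iff.2 ⟨q⟩
      exact div_neg_of_neg_of_pos (by norm_num) (by positivity)
  · rw [tube_eq_pi]
    refine isPreconnected_univ_pi fun k => Convex.isPreconnected ?_
    exact (convex_Ioo _ _).linear_preimage Complex.reLm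

/-- There are exactly `N₁` pairs in all, each with real part above `-2 / (3 N₁)`. -/
theorem neg_two_thirds_lt_sum_cPair (hN : 4 ≤ N) {s : Idx N → ℂ} (hs : s ∈ tube N)
    (C : Finset (Pairs N)) : -2 / 3 < ∑ q ∈ C, cPair (rePart s) q := by
  rcases C.eq_empty_or_nonempty with rfl | hC
  · norm_num
  obtain ⟨q₀, _⟩ := id hC
  have hs := hs.1
  rw [← card_pairs hN] at hs
  have hn : 0 < (Fintype.card (Pairs N) : ℝ) := by exact_mod_cast Fintype.card_pos_iff.2 ⟨q₀⟩
  have h1 : ∑ _q ∈ C, (-2 / (3 * (Fintype.card (Pairs N) : ℝ))) < ∑ q ∈ C, cPair (rePart s) q :=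
    Finset.sum_lt_sum_of_nonempty hC fun q _ => (hs q).1
  have h2 : (C.card : ℝ) ≤ Fintype.card (Pairs N) := by exact_mod_cast C.card_le_univ
  refine lt_of_le_of_lt ?_ h1
  rw [Finset.sum_const, nsmul_eq_mul, mul_div_assoc', div_le_div_iff₀ (by norm_num) (by positivity)]
  nlinarith

theorem pairsWithin_eq_empty {J : Finset (T N)} (hJ : J.card ≤ 1) :
    (Finset.univ.filter fun q : Pairs N => q.1.1 ∈ J ∧ q.1.2 ∈ J) = ∅ := by
  rw [Finset.filter_eq_empty_iff]
  intro q _ hq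
  exact q.2.ne (Finset.card_le_one.1 hJ _ hq.1 _ hq.2)

/-- For `|J| ≥ 2` the expression exceeds `|J| - 2|J|/3 - 2/3 ≥ 0`. For `|J| = 1` this estimate is
too weak, but there are no pairs and `1 - 2/3 > 0` suffices. -/
theorem pos_of_tube (hN : 4 ≤ N) {s : Idx N → ℂ} (hs : s ∈ tube N) {σ : T N → ℝ}
    (hσ : ∀ i, -2 / 3 < σ i) {J : Finset (T N)} (hJ : J.Nonempty) :
    0 < (J.card : ℝ) + ∑ i ∈ J, σ i +
      ∑ q : Pairs N with q.1.1 ∈ J ∧ q.1.2 ∈ J, cPair (rePart s) q := by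
  have h1 : ∑ _i ∈ J, (-2 / 3 : ℝ) < ∑ i ∈ J, σ i :=
    Finset.sum_lt_sum_of_nonempty hJ fun i _ => hσ i
  rw [Finset.sum_const, nsmul_eq_mul] at h1
  have hJ1 : 1 ≤ J.card := Finset.card_pos.2 hJ
  rcases Nat.lt_or_ge J.card 2 with h | h
  · rw [pairsWithin_eq_empty (by omega), Finset.sum_empty]
    have : (1 : ℝ) ≤ J.card := by exact_mod_cast hJ1
    linarith
  · have h2 := neg_two_thirds_lt_sum_cPair hN hs
      (Finset.univ.filter fun q : Pairs N => q.1.1 ∈ J ∧ q.1.2 ∈ J)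
    have : (2 : ℝ) ≤ J.card := by exact_mod_cast h
    linarith

theorem tube_subset_regionH (hN : 4 ≤ N) : tube N ⊆ regionH N := by
  intro s hs
  refine ⟨fun J hJ => ?_, fun K hK => ?_, fun J hJ => ?_, fun J hJ => ?_⟩
  · have h1 : ∑ i ∈ J, (c1 (rePart s) i + cLast (rePart s) i) < ∑ _i ∈ J, (-1 : ℝ) := by
      refine Finset.sum_lt_sum_of_nonempty hJ fun i _ => ?_
      have h2 : c1 (rePart s) i < -1 / 2 := (hs.2.1 i).2
      have h3 : cLast (rePart s) i < -1 / 2 := (hs.2.2 i).2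
      linarith
    rw [Finset.sum_const, nsmul_eq_mul] at h1
    have h2 : ∀ C : Finset (Pairs N), ∑ q ∈ C, cPair (rePart s) q ≤ 0 := fun C =>
      Finset.sum_nonpos fun q _ => (hs.1 q).2.le
    have h3 := h2 (Finset.univ.filter fun q => q.1.1 ∈ J)
    have h4 := h2 (Finset.univ.filter fun q => q.1.1 ∉ J ∧ q.1.2 ∈ J)
    unfold formInfty
    linarith
  · have h1 := neg_two_thirds_lt_sum_cPair hN hs
      (Finset.univ.filter fun q : Pairs N => q.1.1 ∈ K ∧ q.1.2 ∈ K)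
    have : (2 : ℝ) ≤ K.card := by exact_mod_cast hK
    unfold formDiag
    linarith
  · exact pos_of_tube hN hs (fun i => (hs.2.1 i).1) hJ
  · exact pos_of_tube hN hs (fun i => (hs.2.2 i).1) hJ

end Region

/-! ### Divergence -/

section Divergence

variable {p : ℕ} [hp : Fact p.Prime] {N : ℕ}

theorem one_le_enorm_cpow {t : ℝ} (ht : 1 ≤ t) {s : ℂ} (hs : 0 ≤ s.re) :
    1 ≤ ‖(t : ℂ) ^ s‖ₑ := by
  rw [← ofReal_norm, ENNReal.one_le_ofReal, Complex.norm_cpow_eq_rpow_re_of_pos (by linarith)]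
  exact Real.one_le_rpow ht hs

theorem norm_padic_sub_of_lt {x y : ℚ_[p]} (h : ‖x‖ < ‖y‖) : ‖x - y‖ = ‖y‖ := by
  rw [sub_eq_add_neg, Padic.add_eq_max_of_ne (by rw [norm_neg]; exact h.ne), norm_neg,
    max_eq_right h.le]

theorem one_le_enorm_integrand {s : Idx N → ℂ} (hs : ∀ k, 0 ≤ (s k).re) {x : T N → ℚ_[p]}
    (h1 : ∀ i, 1 < ‖x i‖) (h2 : ∀ i j, i < j → ‖x i‖ < ‖x j‖) : 1 ≤ ‖integrand p s x‖ₑ := by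
  rw [integrand, enorm_mul, enorm_finset_prod, enorm_finset_prod]
  refine one_le_mul (Finset.one_le_prod' fun i _ => ?_) (Finset.one_le_prod' fun q _ => ?_)
  · rw [enorm_mul]
    refine one_le_mul (one_le_enorm_cpow (h1 i).le (hs _)) (one_le_enorm_cpow ?_ (hs _))
    rw [norm_padic_sub_of_lt (by simpa using h1 i)]
    exact (h1 i).le
  · refine one_le_enorm_cpow ?_ (hs _)
    rw [norm_padic_sub_of_lt (h2 _ _ q.2)]
    exact (h1 _).le

theorem notMem_Lam {x : T N → ℚ_[p]}
    (h1 : ∀ i, 1 < ‖x i‖) (h2 : ∀ i j, i < j → ‖x i‖ < ‖x j‖) : x ∉ Lam p N := by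
  simp only [Lam, Set.mem_ofPred_eq, mul_eq_zero, Finset.prod_eq_zero_iff, not_or, not_exists,
    Finset.mem_univ, true_and, sub_eq_zero]
  refine ⟨fun i => ⟨fun h => ?_, fun h => ?_⟩, fun q h => ?_⟩
  · have := h1 i
    rw [h, norm_zero] at this
    linarith
  · have := h1 i
    rw [← h, norm_one] at this
    exact lt_irrefl _ this
  · have := h2 _ _ q.2
    rw [h] at this
    exact lt_irrefl _ this

/-- Balls are compact, while `ℚ_p` is not and so has infinite measure. -/
theorem haarQp_compl_closedBall (r : ℝ) : haarQp p (Metric.closedBall 0 r)ᶜ = ∞ := by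
  have hu : haarQp p Set.univ = ∞ := measure_univ_of_isAddLeftInvariant _
  have hf : haarQp p (Metric.closedBall 0 r) ≠ ∞ := (isCompact_closedBall 0 r).measure_lt_top.ne
  rw [measure_compl Metric.isClosed_closedBall.measurableSet hf, hu, ENNReal.top_sub hf]

theorem lintegral_enorm_integrand_eq_top (hN : 4 ≤ N) {s : Idx N → ℂ} (hs : ∀ k, 0 ≤ (s k).re) :
    ∫⁻ x in (Lam p N)ᶜ, ‖integrand p s x‖ₑ ∂(haarN p N) = ⊤ := by
  have hp1 : (1 : ℝ) < p := by exact_mod_cast hp.out.one_lt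
  let m : T N := ⟨N - 2, Finset.mem_Icc.2 ⟨by omega, le_rfl⟩⟩
  have hm : ∀ i : T N, i ≠ m → (i : ℕ) < N - 2 := fun i hi =>
    lt_of_le_of_ne (Finset.mem_Icc.1 i.2).2 fun h => hi (Subtype.ext h)
  -- Spheres of radii `p ^ i` are open, so they have positive measure, and they make the norms
  -- increase. The last index `m = N - 2` ranges over everything beyond `p ^ N`, which makes the
  -- measure of the box infinite.
  let B : T N → Set ℚ_[p] := fun i => if i = m then (Metric.closedBall 0 ((p : ℝ) ^ N))ᶜ else
    Metric.sphere 0 ((p : ℝ) ^ (i : ℕ))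
  have hBm : B m = (Metric.closedBall 0 ((p : ℝ) ^ N))ᶜ := if_pos rfl
  have hBi : ∀ i, i ≠ m → B i = Metric.sphere 0 ((p : ℝ) ^ (i : ℕ)) := fun i hi => if_neg hi
  have hpos : ∀ i, haarQp p (B i) ≠ 0 := by
    intro i
    by_cases hi : i = m
    · rw [hi, hBm, haarQp_compl_closedBall]; exact ENNReal.top_ne_zero
    · rw [hBi i hi]
      refine (IsUltrametricDist.isOpen_sphere (0 : ℚ_[p]) (by positivity)).measure_ne_zero _
        ⟨((p : ℚ_[p]) ^ (i : ℕ))⁻¹, ?_⟩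
      simp
  have hB : haarN p N (Set.univ.pi B) = ∞ := by
    rw [haarN, Measure.pi_pi, ← Finset.mul_prod_erase _ _ (Finset.mem_univ m), hBm,
      haarQp_compl_closedBall, ENNReal.top_mul]
    exact Finset.prod_ne_zero_iff.2 fun i _ => hpos i
  have hBx : ∀ x ∈ Set.univ.pi B, (∀ i, 1 < ‖x i‖) ∧ ∀ i j, i < j → ‖x i‖ < ‖x j‖ := by
    intro x hx
    have hxm : (p : ℝ) ^ N < ‖x m‖ := by
      have := hx m (Set.mem_univ m)
      rw [hBm] at this
      simpa using this
    have hxi : ∀ i, i ≠ m → ‖x i‖ = (p : ℝ) ^ (i : ℕ) := by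
      intro i hi
      have := hx i (Set.mem_univ i)
      rw [hBi i hi] at this
      simpa using this
    refine ⟨fun i => ?_, fun i j hij => ?_⟩
    · by_cases hi : i = m
      · rw [hi]; exact (one_lt_pow₀ hp1 (by omega)).trans hxm
      · rw [hxi i hi]
        exact one_lt_pow₀ hp1 (by have := (Finset.mem_Icc.1 i.2).1; omega)
    · have hi : i ≠ m := by
        rintro rfl
        have h1 : (m : ℕ) < j := hij
        have h2 := (Finset.mem_Icc.1 j.2).2
        have h3 : (m : ℕ) = N - 2 := rfl
        omega
      rw [hxi i hi]
      by_cases hj : j = m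
      · rw [hj]
        exact (pow_lt_pow_right₀ hp1 (by have := hm i hi; omega)).trans hxm
      · rw [hxi j hj]
        exact pow_lt_pow_right₀ hp1 hij
  have hBmeas : MeasurableSet (Set.univ.pi B) := by
    refine MeasurableSet.univ_pi fun i => ?_
    by_cases hi : i = m
    · rw [hi, hBm]; exact Metric.isClosed_closedBall.measurableSet.compl
    · rw [hBi i hi]; exact Metric.isClosed_sphere.measurableSet
  rw [eq_top_iff, ← hB, ← setLIntegral_one]
  refine (setLIntegral_mono' hBmeas fun x hx => ?_).trans
    (lintegral_mono_set (μ := haarN p N) (t := (Lam p N)ᶜ) fun x hx => ?_)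
  · exact one_le_enorm_integrand hs (hBx x hx).1 (hBx x hx).2
  · exact notMem_Lam (hBx x hx).1 (hBx x hx).2

end Divergence

/-! ### The continuation -/

section Continuation

variable {p : ℕ} [hp : Fact p.Prime] {N : ℕ}

theorem exists_rational_continuation :
    ∃ P Q : MvPolynomial (Idx N) ℂ,
      (∀ s, rePart s ∉ polarHyperplanes N → evalAt p Q s ≠ 0) ∧
      ∀ s ∈ regionH N, zeta p N s = evalAt p P s / evalAt p Q s := by
  obtain ⟨P, n, h⟩ := zeta_mem (p := p) (N := N)
  have hQ : ∀ s, evalAt p (commonDenom p N ^ n) s = evalAt p (commonDenom p N) s ^ n := fun s =>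
    map_pow _ _ _
  refine ⟨P, commonDenom p N ^ n, fun s hs => ?_, fun s hs => ?_⟩
  · rw [hQ]
    exact pow_ne_zero _ (evalAt_commonDenom_ne_zero hs)
  · rw [hQ]
    exact h ⟨s, hs⟩

end Continuation

end

end KobaNielsen

theorem mainTheorem1 (p : ℕ) [Fact p.Prime] (N : ℕ) (hN : 4 ≤ N) :
    -- the region of convergence contains a non-empty open connected set
    (IsOpen (KobaNielsen.tube N) ∧ IsConnected (KobaNielsen.tube N) ∧
      KobaNielsen.tube N ⊆ KobaNielsen.regionH N) ∧
    -- the integral converges and is holomorphic there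
    (∀ s ∈ KobaNielsen.regionH N, MeasureTheory.IntegrableOn (KobaNielsen.integrand p s)
      (KobaNielsen.Lam p N)ᶜ (KobaNielsen.haarN p N)) ∧
    IsOpen (KobaNielsen.regionH N) ∧
    AnalyticOnNhd ℂ (KobaNielsen.zeta p N) (KobaNielsen.regionH N) ∧
    -- rational continuation and its poles
    (∃ P Q : MvPolynomial (KobaNielsen.Idx N) ℂ,
      (∀ s ∈ KobaNielsen.regionH N, KobaNielsen.evalAt p Q s ≠ 0 ∧
        KobaNielsen.zeta p N s = KobaNielsen.evalAt p P s / KobaNielsen.evalAt p Q s) ∧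
      ∀ s, KobaNielsen.IsPole p P Q s →
        KobaNielsen.rePart s ∈ KobaNielsen.polarHyperplanes N) ∧
    -- divergence to `+∞`
    (∀ s : KobaNielsen.Idx N → ℂ, (∀ k, 0 ≤ (s k).re) →
      ∫⁻ x in (KobaNielsen.Lam p N)ᶜ, ‖KobaNielsen.integrand p s x‖ₑ
        ∂(KobaNielsen.haarN p N) = ⊤) := by
  obtain ⟨P, Q, hQ, hPQ⟩ := KobaNielsen.exists_rational_continuation (p := p) (N := N)
  have han : ∀ s, KobaNielsen.evalAt p Q s ≠ 0 →
      AnalyticAt ℂ (fun z => KobaNielsen.evalAt p P z / KobaNielsen.evalAt p Q z) s := fun s hs =>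
    (KobaNielsen.analyticAt_evalAt p P s).div (KobaNielsen.analyticAt_evalAt p Q s) hs
  have hQH : ∀ s ∈ KobaNielsen.regionH N, KobaNielsen.evalAt p Q s ≠ 0 := fun s hs =>
    hQ s (KobaNielsen.notMem_polarHyperplanes hs)
  refine ⟨⟨KobaNielsen.isOpen_tube, KobaNielsen.isConnected_tube hN,
    KobaNielsen.tube_subset_regionH hN⟩, fun s hs => KobaNielsen.integrableOn_integrand hs,
    KobaNielsen.isOpen_regionH, fun s hs => ?_, ⟨P, Q, fun s hs => ⟨hQH s hs, hPQ s hs⟩,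
    fun s hs => ?_⟩, fun s hs => KobaNielsen.lintegral_enorm_integrand_eq_top hN hs⟩
  -- The region is open, so `zeta` agrees with the rational function near `s`.
  · refine (han s (hQH s hs)).congr ?_
    filter_upwards [KobaNielsen.isOpen_regionH.mem_nhds hs] with z hz
    exact (hPQ z hz).symm
  · by_contra hpol
    -- Off the hyperplanes the quotient is analytic, hence is its own extension.
    exact hs ⟨_, han s (hQ s hpol), Filter.Eventually.of_forall fun z _ => rfl⟩
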